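/- **Setting.** Let $n\in\mathbb N$, $T>0$, $\tau\in(0,1]$, $p>0$, $s>0$, and let $\gamma$ be positive and integrable on $(0,T)$. Write $\|\cdot\|$ for the norm of $L^2(\mathbb R^n)$ (complex-valued functions), $\hat f(\xi)=\mathcal F f(\xi)=\int_{\mathbb R^n} f(x)e^{-2\pi i x\cdot\xi}\,dx$ for the Fourier transform (extended to $L^2$), and $\|f\|_{H^p}=\|(1+|\xi|^2)^{p/2}\hat f\|$. Consider the final value problem $$\partial_t u+\gamma(t)(-\Delta_x)^{\tau}u=0\ \text{ in }\mathbb R^n\times(0,T),\qquad u(\cdot,T)=g\in L^2(\mathbb R^n),$$ where $(-\Delta)^\tau$ has symbol $|2\pi\xi|^{2\tau}$ and the equation is understood on the Fourier side: for a.e. $\xi$, $t\mapsto\hat u(\xi,t)$ is continuous on $[0,T]$ and $\hat u(\xi,t)=\hat u(\xi,0)-\int_0^t\gamma(r)|2\pi\xi|^{2\tau}\hat u(\xi,r)\,dr$ for $t\in[0,T]$. Put $\psi(\xi)=\exp\bigl(-|2\pi\xi|^{2\tau}\int_0^T\gamma\bigr)$, $A=\mathcal F^{-1}\psi\,\mathcal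 F$ on $L^2(\mathbb R^n)$, and $\bar A=A/\sqrt e$. Let $\phi\in L^1(\mathbb R^n)$ be real-valued with $\int\phi=1$, $|\hat\phi(\xi)|<1$ for $\xi\ne0$, and $|1-\hat\phi(\xi)|$ of exact order $|\xi|^s$ as $\xi\to0$ (bounded above and below by positive multiples of $|\xi|^s$ near $0$). Let $\phi_\beta(x)=\beta^{-n}\phi(x/\beta)$ and $C_\beta f=\phi_\beta\star f$ for $\beta>0$. For $h\in L^2(\mathbb R^n)$ the regularized solution with data $h$ is the minimiser over $v\in L^2(\mathbb R^n)$ of $$J_\beta(v,A,h)=\|Av-h\|^2+\|(I-C_\beta)v\|^2 .$$ Let $q=p/(2\tau)$ and, for $t\in(0,1)$, $f_q(t)=(-\ln t)^{-q}$ and $\Theta_q(t)=\sqrt t\,f_q(t)$; $\Theta_q$ is a bijection from $(0,1)$ onto $(0,\infty)$. The operator $f_q(\bar A^*\bar A)$ is the Fourier multiplier with symbol $f_q(\psi(\xi)^2/e)$. **Theorem.** 1. For every $\beta>0$ and every $h\in L^2(\mathbb R^n)$, $J_\beta(\cdot,A,h)$ has exactly one minimiser in $L^2(\mathbb R^n)$.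 2. There is a constant $C(p)>0$ such that for every $E>0$ and every $f$ with $\|f\|_{H^p}\le E$ one has $f=f_q(\bar A^*\bar A)w$ for some $w\in L^2(\mathbb R^n)$ with $\|w\|\le C(p)E$. 3. Let $C(p)>0$ be the constant of part 2, or in fact any positive constant. There is a constant $K>0$, independent of $E$ and $\delta$, such that for every $E>0$, with $\rho=C(p)E$ and the a-priori choice $$\beta(\delta)=\bigl(\Theta_q^{-1}(\delta/\rho)\bigr)^{1/(2s)},$$ the following holds: whenever $u$ is a solution of the final value problem with $\|u(\cdot,0)\|_{H^p}\le E$, $g^\delta\in L^2(\mathbb R^n)$ satisfies $\|g-g^\delta\|\le\delta$ with $g=u(\cdot,T)$, and $u^\delta_{\beta(\delta)}$ is the regularized solution with data $g^\delta$ and parameter $\beta=\beta(\delta)$, then $$\|u(\cdot,0)-u^\delta_{\beta(\delta)}\|\le K\,\rho\,f_q\!\left(\frac{\delta^2}{\rho^2}\right)(1+o(1))\qquad\text{as }\delta\downarrow0,$$ where the $o(1)$ term depends on $E$ and $\delta$ but not on $u$, $g$, $g^\delta$. -/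

import Mathlib

open MeasureTheory Filter Topology Set
open scoped FourierTransform Convolution

noncomputable section

namespace BackwardHeat

/-- The Euclidean space `ℝⁿ`. -/
abbrev Rn (n : ℕ) : Type := EuclideanSpace ℝ (Fin n)

/-- The Hilbert space `L²(ℝⁿ)` of complex-valued square integrable functions. -/
abbrev L2 (n : ℕ) : Type := Lp ℂ 2 (volume : Measure (Rn n))

/-- The symbol `|2πξ|^{2τ}` of the fractional Laplacian `(-Δ)^τ`, for the Fourier transform
`𝓕 f ξ = ∫ f(x) e^{-2πi x·ξ} dx`. -/
def fracSymbol {n : ℕ} (τ : ℝ) (ξ : Rn n) : ℝ := ‖(2 * Real.pi) • ξ‖ ^ (2 * τ)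

/-- `u : [0,T] → L²(ℝⁿ)` solves `∂ₜu + γ(t) (-Δ)^τ u = 0` on `(0,T)`. On the Fourier side this is,
for almost every frequency `ξ`, the linear ODE `∂ₜû(ξ,t) = -γ(t) |2πξ|^{2τ} û(ξ,t)`; as `γ` is only
integrable, the ODE is understood in the sense of Carathéodory, that is, in integrated form for a
function `t ↦ v t ξ` continuous on `[0,T]`. -/
def IsSolution {n : ℕ} (τ : ℝ) (γ : ℝ → ℝ) (T : ℝ) (u : ℝ → L2 n) : Prop :=
  ∃ v : ℝ → Rn n → ℂ,
    (∀ t ∈ Icc 0 T, (𝓕 (u t) : L2 n) =ᵐ[volume] v t) ∧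
    ∀ᵐ ξ ∂(volume : Measure (Rn n)),
      ContinuousOn (fun t => v t ξ) (Icc 0 T) ∧
      ∀ t ∈ Icc 0 T,
        v t ξ = v 0 ξ - ∫ r in (0 : ℝ)..t, ((γ r * fracSymbol τ ξ : ℝ) : ℂ) * v r ξ

/-- The Fourier multiplier `f ↦ 𝓕⁻¹ (m 𝓕 f)` on `L²(ℝⁿ)`. It is used for bounded measurable
symbols `m` only, for which `m 𝓕 f` always lies in `L²`: see `memLp_mul_fourier`. -/
def fourierMul {n : ℕ} (m : Rn n → ℝ) (f : L2 n) : L2 n :=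
  open Classical in
  if h : MemLp (fun ξ => (m ξ : ℂ) * (𝓕 f : L2 n) ξ) 2 volume then 𝓕⁻ (h.toLp _ : L2 n) else 0

theorem memLp_mul_fourier {n : ℕ} {m : Rn n → ℝ} (hm : Measurable m) {c : ℝ}
    (hc : ∀ ξ, |m ξ| ≤ c) (f : L2 n) :
    MemLp (fun ξ => (m ξ : ℂ) * (𝓕 f : L2 n) ξ) 2 volume := by
  refine MemLp.of_le_mul (c := c) (Lp.memLp (𝓕 f : L2 n)) ?_ ?_
  · exact (Complex.measurable_ofReal.comp hm).aestronglyMeasurable.mul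
      (Lp.aestronglyMeasurable (𝓕 f : L2 n))
  · refine Eventually.of_forall fun ξ => ?_
    rw [norm_mul, Complex.norm_real, Real.norm_eq_abs]
    exact mul_le_mul_of_nonneg_right (hc ξ) (norm_nonneg _)

/-- `ψ(ξ) = exp (-|2πξ|^{2τ} ∫₀ᵀ γ)`. -/
def psi {n : ℕ} (τ : ℝ) (γ : ℝ → ℝ) (T : ℝ) (ξ : Rn n) : ℝ :=
  Real.exp (-(fracSymbol τ ξ * ∫ r in (0 : ℝ)..T, γ r))

/-- The forward operator `A = 𝓕⁻¹ ψ 𝓕`, mapping `u(·,0)` to `u(·,T)`. -/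
def opA {n : ℕ} (τ : ℝ) (γ : ℝ → ℝ) (T : ℝ) (f : L2 n) : L2 n :=
  fourierMul (psi τ γ T) f

/-- The Fourier transform `φ̂` of an integrable real-valued function `φ`. -/
def kernelHat {n : ℕ} (φ : Rn n → ℝ) : Rn n → ℂ :=
  𝓕 (fun x => (φ x : ℂ))

/-- `φ_β(x) = β⁻ⁿ φ(x/β)`. -/
def scaledKernel {n : ℕ} (φ : Rn n → ℝ) (β : ℝ) (x : Rn n) : ℝ :=
  (1 / β ^ n) * φ (β⁻¹ • x)

/-- The mollifier `C_β f = φ_β ⋆ f`. By Young's inequality `φ_β ⋆ f` always lies in `L²` when `φ` is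
integrable. -/
def mollify {n : ℕ} (φ : Rn n → ℝ) (β : ℝ) (f : L2 n) : L2 n :=
  open Classical in
  if h : MemLp (scaledKernel φ β ⋆[ContinuousLinearMap.lsmul ℝ ℝ, volume] (f : Rn n → ℂ)) 2 volume
  then h.toLp _ else 0

/-- The functional `J_β(v, A, h) = ‖A v - h‖² + ‖(I - C_β) v‖²`. -/
def functionalJ {n : ℕ} (τ : ℝ) (γ : ℝ → ℝ) (T : ℝ) (φ : Rn n → ℝ) (β : ℝ) (h v : L2 n) : ℝ :=
  ‖opA τ γ T v - h‖ ^ 2 + ‖v - mollify φ β v‖ ^ 2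

/-- `v` is a minimiser of `J_β(·, A, h)` over `L²(ℝⁿ)`. -/
def IsRegularizedSolution {n : ℕ} (τ : ℝ) (γ : ℝ → ℝ) (T : ℝ) (φ : Rn n → ℝ) (β : ℝ)
    (h v : L2 n) : Prop :=
  IsMinOn (functionalJ τ γ T φ β h) univ v

/-- The Sobolev norm `‖f‖_{H^p} = ‖(1 + |ξ|²)^{p/2} 𝓕 f‖_{L²}`, with value `∞` exactly when
`f ∉ H^p(ℝⁿ)`. -/
def sobolevNorm {n : ℕ} (p : ℝ) (f : L2 n) : ENNReal :=
  eLpNorm (fun ξ => (((1 + ‖ξ‖ ^ 2) ^ (p / 2) : ℝ) : ℂ) * (𝓕 f : L2 n) ξ) 2 volume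

/-- `f_q(t) = (-ln t)^{-q}`, used for `t ∈ (0,1)`. -/
def logRate (q t : ℝ) : ℝ := (-Real.log t) ^ (-q)

/-- `Θ_q(t) = √t f_q(t)`, used for `t ∈ (0,1)`. -/
def Theta (q t : ℝ) : ℝ := Real.sqrt t * logRate q t

/-- The inverse `Θ_q⁻¹ : (0,∞) → (0,1)` of the bijection `Θ_q : (0,1) → (0,∞)`. -/
def thetaInv (q y : ℝ) : ℝ := Function.invFunOn (Theta q) (Ioo 0 1) y

/-- The operator `f_q(Ā*Ā)` with `Ā = A/√e`. As `Ā*Ā = 𝓕⁻¹ (ψ/√e)² 𝓕`, it is the Fourier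
multiplier with symbol `f_q((ψ/√e)²)`. -/
def logSourceOp {n : ℕ} (τ : ℝ) (γ : ℝ → ℝ) (T : ℝ) (q : ℝ) (w : L2 n) : L2 n :=
  fourierMul (fun ξ => logRate q ((psi τ γ T ξ / Real.sqrt (Real.exp 1)) ^ 2)) w

/-- The a-priori choice `β(δ) = (Θ_q⁻¹(δ/ρ))^{1/(2s)}`. -/
def betaRule (q s ρ δ : ℝ) : ℝ := (thetaInv q (δ / ρ)) ^ (1 / (2 * s))

theorem theta_bijOn {q : ℝ} (hq : 0 < q) : BijOn (Theta q) (Ioo 0 1) (Ioi 0) := by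
  have hlog : ∀ t ∈ Ioo (0 : ℝ) 1, 0 < -Real.log t := fun t ht =>
    neg_pos.2 (Real.log_neg ht.1 ht.2)
  have hpos : ∀ t ∈ Ioo (0 : ℝ) 1, 0 < logRate q t := fun t ht =>
    Real.rpow_pos_of_pos (hlog t ht) _
  have hmono : StrictMonoOn (Theta q) (Ioo 0 1) := by
    intro a ha b hb hab
    have h1 : logRate q a ≤ logRate q b := by
      refine Real.rpow_le_rpow_of_nonpos (hlog b hb) ?_ (by linarith)
      exact neg_le_neg (Real.log_le_log ha.1 hab.le)
    exact mul_lt_mul (Real.sqrt_lt_sqrt ha.1.le hab) h1 (hpos a ha) (Real.sqrt_nonneg _)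
  have hcont : ContinuousOn (Theta q) (Ioo 0 1) := by
    refine Real.continuous_sqrt.continuousOn.mul ?_
    refine ContinuousOn.rpow_const ?_ fun t ht => Or.inl (hlog t ht).ne'
    exact (Real.continuousOn_log.mono fun t ht => ht.1.ne').neg
  have hlim1 : Tendsto (Theta q) (𝓝[<] 1) atTop := by
    have hl : Tendsto (fun t : ℝ => -Real.log t) (𝓝[<] 1) (𝓝[>] 0) := by
      refine tendsto_nhdsWithin_iff.2 ⟨?_, ?_⟩
      · have h := (Real.continuousAt_log (one_ne_zero)).tendsto.neg
        rw [Real.log_one, neg_zero] at h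
        exact h.mono_left nhdsWithin_le_nhds
      · filter_upwards [Ioo_mem_nhdsLT (zero_lt_one (α := ℝ))] with t ht using hlog t ht
    have h2 := (tendsto_rpow_neg_nhdsGT_zero (neg_lt_zero.2 hq)).comp hl
    have h3 : Tendsto (fun t : ℝ => Real.sqrt t) (𝓝[<] 1) (𝓝 1) := by
      have := (Real.continuous_sqrt.tendsto 1).mono_left (nhdsWithin_le_nhds (s := Iio 1))
      simpa using this
    exact h3.pos_mul_atTop one_pos h2
  have hlim0 : Tendsto (Theta q) (𝓝[>] 0) (𝓝 0) := by
    have hl : Tendsto (fun t : ℝ => -Real.log t) (𝓝[>] 0) atTop :=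
      tendsto_neg_atBot_atTop.comp Real.tendsto_log_nhdsGT_zero
    have h2 := (tendsto_rpow_neg_atTop hq).comp hl
    have h3 : Tendsto (fun t : ℝ => Real.sqrt t) (𝓝[>] 0) (𝓝 0) := by
      have := (Real.continuous_sqrt.tendsto 0).mono_left (nhdsWithin_le_nhds (s := Ioi 0))
      simpa using this
    have h4 := h3.mul h2
    rw [zero_mul] at h4
    exact h4
  refine ⟨fun t ht => mul_pos (Real.sqrt_pos.2 ht.1) (hpos t ht), hmono.injOn, fun y hy => ?_⟩
  obtain ⟨a, hay, ha⟩ := ((hlim0.eventually (gt_mem_nhds hy)).and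
    (Ioo_mem_nhdsGT (zero_lt_one (α := ℝ)))).exists
  obtain ⟨b, hby, hb⟩ := ((hlim1.eventually_gt_atTop y).and
    (Ioo_mem_nhdsLT (zero_lt_one (α := ℝ)))).exists
  exact (isPreconnected_Ioo.image _ hcont).ordConnected.out ⟨a, ha, rfl⟩ ⟨b, hb, rfl⟩
    ⟨hay.le, hby.le⟩

end BackwardHeat

end

namespace BackwardHeat

/-! ### Plancherel and Fourier multipliers on `L²` -/

variable {n : ℕ}

/-! On the Fourier side every operator is a multiplication. Write `m = 1 - φ̂(β·)` and `N = ψ² +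
|m|²`. By Plancherel, `J_β(v)` is the integral of `|ψ v̂ - ĥ|² + |m v̂|²`. Completing the square
pointwise (`complete_square`) turns this into `N |v̂ - (ψ/N) ĥ|²` plus a term free of `v`. Since `N
> 0` and `ψ/N` is bounded for fixed `β`, the unique minimiser has transform `(ψ/N) ĥ`.

A solution satisfies `û(T) = ψ û(0)`, so the error has transform `(|m|²/N) û(0) + (ψ/N)(ĝ - ĝδ)`, a
bias plus a noise term (`norm_sub_le_of_symbol_le`).

Noise (`exists_psi_div_normalSymbol_le`): `ψ/N ≤ c / min(1, β^s)`. For `|ξ| ≤ 1` the symbol `ψ` is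
bounded below; for `|ξ| ≥ 1` one has `|m| ≥ c min(1, β^s)` and `ψ|m| ≤ N`.

Bias (`exists_sq_div_normalSymbol_le`): split at a radius `R` with `R^{2τ}` proportional to
`log(1/β)`. Below `R`, `ψ² ≥ β^s` while `|m|² ≲ (βR)^{2s}`, so the quotient is a power of `β` up to
logarithms. Above `R`, the quotient is at most 1 and the `H^p` weight, at least `R^p`, supplies the
factor `(log(1/β))^{-q}`.

For `α = Θ_q⁻¹(δ/ρ)` and `β^s = √α`, both terms are `O(ρ f_q(α))`, and `f_q(α)` is at most a
constant times `f_q(Θ_q(α)²) = f_q(δ²/ρ²)`. The rate uses the `H^p` bound directly; the source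
condition enters only in part 2, where the weight `(1+|ξ|²)^{p/2}` dominates `1/f_q(ψ²/e)`. -/

theorem exists_fourier_ae_eq {F : Rn n → ℂ} (hF : MemLp F 2 volume) :
    ∃ f : L2 n, (𝓕 f : L2 n) =ᵐ[volume] F :=
  ⟨𝓕⁻ (hF.toLp F), by
    rw [FourierTransform.fourier_fourierInv_eq]
    exact hF.coeFn_toLp⟩

theorem fourier_fourierMul {m : Rn n → ℝ} (hm : Measurable m) {c : ℝ}
    (hc : ∀ ξ, |m ξ| ≤ c) (f : L2 n) :
    (𝓕 (fourierMul m f) : L2 n) =ᵐ[volume] fun ξ => (m ξ : ℂ) * (𝓕 f : L2 n) ξ := by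
  have h := memLp_mul_fourier hm hc f
  rw [fourierMul, dif_pos h, FourierTransform.fourier_fourierInv_eq]
  exact h.coeFn_toLp

theorem eq_of_fourier_ae_eq {f g : L2 n}
    (h : (𝓕 f : L2 n) =ᵐ[volume] (𝓕 g : L2 n)) : f = g := by
  have h' : (𝓕 f : L2 n) = 𝓕 g := Lp.ext h
  exact (Lp.fourierTransformₗᵢ (Rn n) ℂ).injective h'

theorem fourier_sub_ae (f g : L2 n) :
    (𝓕 (f - g) : L2 n) =ᵐ[volume] fun ξ => (𝓕 f : L2 n) ξ - (𝓕 g : L2 n) ξ := by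
  have h : (𝓕 (f - g) : L2 n) = 𝓕 f - 𝓕 g := (Lp.fourierTransformₗᵢ (Rn n) ℂ).map_sub f g
  rw [h]
  exact Lp.coeFn_sub _ _

theorem norm_sq_eq_integral_fourier (f : L2 n) :
    ‖f‖ ^ 2 = ∫ ξ, ‖(𝓕 f : L2 n) ξ‖ ^ 2 := by
  have h := L2.inner_def (𝕜 := ℂ) (𝓕 f : L2 n) (𝓕 f : L2 n)
  rw [inner_self_eq_norm_sq_to_K, Lp.norm_fourier_eq] at h
  have h2 : ∀ ξ, inner ℂ ((𝓕 f : L2 n) ξ) ((𝓕 f : L2 n) ξ)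
      = ((‖(𝓕 f : L2 n) ξ‖ ^ 2 : ℝ) : ℂ) := fun ξ => by
    rw [inner_self_eq_norm_sq_to_K]; norm_cast
  simp_rw [h2] at h
  rw [integral_complex_ofReal] at h
  have h3 : ((‖f‖ ^ 2 : ℝ) : ℂ) = ((∫ ξ, ‖(𝓕 f : L2 n) ξ‖ ^ 2 : ℝ) : ℂ) := by
    rw [← h]; norm_cast
  exact Complex.ofReal_injective h3

theorem ofReal_norm_eq_eLpNorm_fourier (f : L2 n) :
    ENNReal.ofReal ‖f‖ = eLpNorm (𝓕 f : L2 n) 2 volume := by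
  rw [← Lp.norm_fourier_eq, Lp.norm_def, ENNReal.ofReal_toReal (Lp.eLpNorm_ne_top _)]

/-- The integral and the `L²` Fourier transform agree on `L¹ ∩ L²`. -/
theorem fourier_toLp_ae_eq {f : Rn n → ℂ} (hf : Integrable f volume) (hf2 : MemLp f 2 volume) :
    (𝓕 (hf2.toLp f) : L2 n) =ᵐ[volume] (𝓕 f : Rn n → ℂ) := by
  have hcont : Continuous (𝓕 f : Rn n → ℂ) :=
    VectorFourier.fourierIntegral_continuous Real.continuous_fourierChar continuous_inner hf
  -- Both sides are compared as distributions: against a test function, each transform moves onto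
  -- the test function.
  refine ae_eq_of_integral_contDiff_smul_eq ?_ hcont.locallyIntegrable fun g hg hgs => ?_
  · exact (Lp.memLp _).locallyIntegrable (by norm_num)
  have hgc : HasCompactSupport (fun x => (g x : ℂ)) :=
    hgs.comp_left (g := fun r : ℝ => (r : ℂ)) (by simp)
  have hgd : ContDiff ℝ (⊤ : ℕ∞) (fun x => (g x : ℂ)) := Complex.ofRealCLM.contDiff.comp hg
  let G : SchwartzMap (Rn n) ℂ := hgc.toSchwartzMap hgd
  have hG : ∀ x, G x = (g x : ℂ) := fun x => rfl
  have h1 := congrArg (fun D => D G) (Lp.fourier_toTemperedDistribution_eq (hf2.toLp f))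
  simp only [TemperedDistribution.fourier_apply, Lp.toTemperedDistribution_apply] at h1
  simp only [hG] at h1
  have h2 : ∫ x, (𝓕 G : SchwartzMap (Rn n) ℂ) x • (hf2.toLp f : Rn n → ℂ) x
      = ∫ x, (𝓕 G : SchwartzMap (Rn n) ℂ) x • f x := by
    refine integral_congr_ae ?_
    filter_upwards [hf2.coeFn_toLp] with x hx
    rw [hx]
  have h3 : ∫ x, (𝓕 G : SchwartzMap (Rn n) ℂ) x • f x = ∫ x, G x • (𝓕 f : Rn n → ℂ) x := by
    have := VectorFourier.integral_fourierIntegral_smul_eq_flip (L := innerₗ (Rn n))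
      Real.continuous_fourierChar continuous_inner (G.integrable (μ := volume)) hf
    rw [SchwartzMap.fourier_coe]
    rw [flip_innerₗ] at this
    exact this
  have h4 := h1.symm.trans (h2.trans h3)
  simpa [hG] using h4

/-! ### Convolution of an `L¹` and an `L²` function -/

section Young

variable {φ : Rn n → ℝ} {f : Rn n → ℂ}

/-- Cauchy–Schwarz after the splitting `|φ||f| = |φ|^{1/2} · (|φ||f|²)^{1/2}`. -/
theorem lintegral_enorm_mul_sq_le (hφ : AEStronglyMeasurable φ volume)
    (hf : AEStronglyMeasurable f volume) (x : Rn n) :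
    (∫⁻ y, ‖φ y‖ₑ * ‖f (x - y)‖ₑ) ^ (2 : ℝ) ≤
      (∫⁻ y, ‖φ y‖ₑ) * ∫⁻ y, ‖φ y‖ₑ * ‖f (x - y)‖ₑ ^ (2 : ℝ) := by
  have hfx : AEMeasurable (fun y => ‖f (x - y)‖ₑ) volume :=
    (hf.comp_quasiMeasurePreserving
      (quasiMeasurePreserving_sub_left_of_right_invariant volume x)).enorm
  have h := ENNReal.lintegral_mul_norm_pow_le (μ := volume) hφ.enorm
    (hφ.enorm.mul (hfx.pow_const (2 : ℝ))) (p := 1 / 2) (q := 1 / 2)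
    (by norm_num) (by norm_num) (by norm_num)
  have h2 : ∀ y, ‖φ y‖ₑ ^ (1 / 2 : ℝ) * (‖φ y‖ₑ * ‖f (x - y)‖ₑ ^ (2 : ℝ)) ^ (1 / 2 : ℝ)
      = ‖φ y‖ₑ * ‖f (x - y)‖ₑ := fun y => by
    rw [ENNReal.mul_rpow_of_nonneg _ _ (by norm_num), ← mul_assoc,
      ← ENNReal.rpow_add_of_nonneg _ _ (by norm_num) (by norm_num), ← ENNReal.rpow_mul]
    norm_num
  simp only [Pi.mul_apply, h2] at h
  calc _ ≤ _ := ENNReal.rpow_le_rpow h (by norm_num : (0 : ℝ) ≤ 2)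
    _ = _ := by
      rw [ENNReal.mul_rpow_of_nonneg _ _ (by norm_num), ← ENNReal.rpow_mul, ← ENNReal.rpow_mul]
      norm_num

/-- Integrate the pointwise bound in `x`, then use Tonelli and translation invariance. -/
theorem lintegral_lintegral_enorm_mul_sq_le (hφ : AEStronglyMeasurable φ volume)
    (hf : AEStronglyMeasurable f volume) :
    ∫⁻ x, (∫⁻ y, ‖φ y‖ₑ * ‖f (x - y)‖ₑ) ^ (2 : ℝ) ≤
      (∫⁻ y, ‖φ y‖ₑ) ^ (2 : ℝ) * ∫⁻ y, ‖f y‖ₑ ^ (2 : ℝ) := by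
  have hm : AEMeasurable (Function.uncurry fun x y : Rn n => ‖φ y‖ₑ * ‖f (x - y)‖ₑ ^ (2 : ℝ))
      (volume.prod volume) :=
    hφ.comp_snd.enorm.mul ((hf.comp_quasiMeasurePreserving
      (quasiMeasurePreserving_sub_of_right_invariant volume volume)).enorm.pow_const _)
  have hfm : ∀ y : Rn n, AEMeasurable (fun x => ‖f (x - y)‖ₑ ^ (2 : ℝ)) volume := fun y =>
    (hf.comp_quasiMeasurePreserving
      (measurePreserving_sub_right volume y).quasiMeasurePreserving).enorm.pow_const _
  calc _ ≤ ∫⁻ x, (∫⁻ y, ‖φ y‖ₑ) * ∫⁻ y, ‖φ y‖ₑ * ‖f (x - y)‖ₑ ^ (2 : ℝ) :=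
        lintegral_mono fun x => lintegral_enorm_mul_sq_le hφ hf x
    _ = (∫⁻ y, ‖φ y‖ₑ) * ∫⁻ x, ∫⁻ y, ‖φ y‖ₑ * ‖f (x - y)‖ₑ ^ (2 : ℝ) :=
        lintegral_const_mul'' _ hm.lintegral_prod_right'
    _ = (∫⁻ y, ‖φ y‖ₑ) * ∫⁻ y, ∫⁻ x, ‖φ y‖ₑ * ‖f (x - y)‖ₑ ^ (2 : ℝ) := by
        rw [lintegral_lintegral_swap hm]
    _ = (∫⁻ y, ‖φ y‖ₑ) * ∫⁻ y, ‖φ y‖ₑ * ∫⁻ x, ‖f x‖ₑ ^ (2 : ℝ) := by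
        congr 1
        refine lintegral_congr fun y => ?_
        rw [lintegral_const_mul'' _ (hfm y)]
        rw [lintegral_sub_right_eq_self (fun x => ‖f x‖ₑ ^ (2 : ℝ)) y]
    _ = _ := by
        rw [lintegral_mul_const'' _ hφ.enorm, ← mul_assoc]
        congr 1
        rw [ENNReal.rpow_two, sq]

theorem eLpNorm_lintegral_enorm_mul_le (hφ : AEStronglyMeasurable φ volume)
    (hf : AEStronglyMeasurable f volume) :
    eLpNorm (fun x => ∫⁻ y, ‖φ y‖ₑ * ‖f (x - y)‖ₑ) 2 volume ≤
      eLpNorm φ 1 volume * eLpNorm f 2 volume := by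
  rw [eLpNorm_one_eq_lintegral_enorm,
    eLpNorm_eq_lintegral_rpow_enorm_toReal (by norm_num) (by norm_num),
    eLpNorm_eq_lintegral_rpow_enorm_toReal (by norm_num) (by norm_num)]
  simp only [ENNReal.toReal_ofNat, enorm_eq_self]
  refine (ENNReal.rpow_le_rpow (lintegral_lintegral_enorm_mul_sq_le hφ hf)
    (by norm_num)).trans_eq ?_
  rw [ENNReal.mul_rpow_of_nonneg _ _ (by norm_num), ← ENNReal.rpow_mul]
  norm_num

/-- Young's convolution inequality for an `L¹` and an `L²` function. -/
theorem eLpNorm_convolution_le (hφ : AEStronglyMeasurable φ volume)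
    (hf : AEStronglyMeasurable f volume) :
    eLpNorm (φ ⋆[ContinuousLinearMap.lsmul ℝ ℝ, volume] f) 2 volume ≤
      eLpNorm φ 1 volume * eLpNorm f 2 volume := by
  refine le_trans (eLpNorm_mono_enorm fun x => ?_) (eLpNorm_lintegral_enorm_mul_le hφ hf)
  refine (enorm_integral_le_lintegral_enorm _).trans_eq ?_
  rw [enorm_eq_self]
  exact lintegral_congr fun y => by rw [ContinuousLinearMap.lsmul_apply, enorm_smul]

theorem aestronglyMeasurable_convolution (hφ : AEStronglyMeasurable φ volume)
    (hf : AEStronglyMeasurable f volume) :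
    AEStronglyMeasurable (φ ⋆[ContinuousLinearMap.lsmul ℝ ℝ, volume] f) volume :=
  (hφ.convolution_integrand (ContinuousLinearMap.lsmul ℝ ℝ) hf).integral_prod_right'

theorem memLp_convolution (hφ : Integrable φ volume) (hf : MemLp f 2 volume) :
    MemLp (φ ⋆[ContinuousLinearMap.lsmul ℝ ℝ, volume] f) 2 volume :=
  ⟨aestronglyMeasurable_convolution hφ.1 hf.1, (eLpNorm_convolution_le hφ.1 hf.1).trans_lt
    (ENNReal.mul_lt_top (memLp_one_iff_integrable.2 hφ).2 hf.2)⟩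

/-- A function with finite square integral is finite almost everywhere. Existence is needed because
the convolution is additive in `f` only where it converges. -/
theorem ae_convolutionExistsAt (hφ : Integrable φ volume) (hf : MemLp f 2 volume) :
    ∀ᵐ x, ConvolutionExistsAt φ f x (ContinuousLinearMap.lsmul ℝ ℝ) volume := by
  have hm : AEMeasurable (Function.uncurry fun x y : Rn n => ‖φ y‖ₑ * ‖f (x - y)‖ₑ)
      (volume.prod volume) :=
    hφ.1.comp_snd.enorm.mul (hf.1.comp_quasiMeasurePreserving
      (quasiMeasurePreserving_sub_of_right_invariant volume volume)).enorm
  have hfin : ∫⁻ x, (∫⁻ y, ‖φ y‖ₑ * ‖f (x - y)‖ₑ) ^ (2 : ℝ) ≠ ⊤ := by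
    refine ne_top_of_le_ne_top ?_ (lintegral_lintegral_enorm_mul_sq_le hφ.1 hf.1)
    refine ENNReal.mul_ne_top (ENNReal.rpow_ne_top_of_nonneg (by norm_num) hφ.2.ne) ?_
    have := lintegral_rpow_enorm_lt_top_of_eLpNorm_lt_top (by norm_num) (by norm_num) hf.2
    simpa using this.ne
  filter_upwards [ae_lt_top' (hm.lintegral_prod_right'.pow_const _) hfin] with x hx
  refine ⟨hφ.1.convolution_integrand_snd _ hf.1 x, ?_⟩
  rw [HasFiniteIntegral]
  simp only [ContinuousLinearMap.lsmul_apply, enorm_smul]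
  by_contra h
  rw [not_lt, top_le_iff] at h
  simp [h] at hx

end Young

/-! ### The mollifier as a Fourier multiplier -/

theorem mollify_eq {φ : Rn n → ℝ} {β : ℝ} (hφ : Integrable (scaledKernel φ β) volume) (f : L2 n) :
    mollify φ β f = (memLp_convolution hφ (Lp.memLp f)).toLp _ := by
  rw [mollify, dif_pos]

theorem convolution_lsmul_eq_mul (φ : Rn n → ℝ) (f : Rn n → ℂ) :
    φ ⋆[ContinuousLinearMap.lsmul ℝ ℝ, volume] f =
      (fun x => (φ x : ℂ)) ⋆[ContinuousLinearMap.mul ℂ ℂ, volume] f := by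
  ext x
  simp [convolution]

theorem norm_kernelHat_le (φ : Rn n → ℝ) (ξ : Rn n) : ‖kernelHat φ ξ‖ ≤ ∫ x, ‖φ x‖ := by
  refine (VectorFourier.norm_fourierIntegral_le_integral_norm _ _ _ _ _).trans_eq ?_
  simp

theorem continuous_kernelHat {φ : Rn n → ℝ} (hφ : Integrable φ volume) :
    Continuous (kernelHat φ) :=
  VectorFourier.fourierIntegral_continuous Real.continuous_fourierChar continuous_inner hφ.ofReal

theorem memLp_bounded_mul {m F : Rn n → ℂ} (hm : AEStronglyMeasurable m volume) {c : ℝ}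
    (hc : ∀ ξ, ‖m ξ‖ ≤ c) (hF : MemLp F 2 volume) :
    MemLp (fun ξ => m ξ * F ξ) 2 volume :=
  MemLp.of_le_mul (c := c) hF (hm.mul hF.1) (Eventually.of_forall fun ξ => by
    rw [norm_mul]
    exact mul_le_mul_of_nonneg_right (hc ξ) (norm_nonneg _))

theorem continuous_of_map_add_of_norm_le {T : L2 n → L2 n} (hadd : ∀ f g, T (f + g) = T f + T g)
    {c : ℝ} (hc : ∀ f, ‖T f‖ ≤ c * ‖f‖) : Continuous T :=
  AddMonoidHomClass.continuous_of_bound (AddMonoidHom.mk' T hadd) c hc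

theorem continuous_toLp_convolution {φ : Rn n → ℝ} (hφ : Integrable φ volume) :
    Continuous fun f : L2 n => ((memLp_convolution hφ (Lp.memLp f)).toLp _ : L2 n) := by
  refine continuous_of_map_add_of_norm_le (c := (eLpNorm φ 1 volume).toReal)
    (fun f g => ?_) fun f => ?_
  · rw [← MemLp.toLp_add, MemLp.toLp_eq_toLp_iff]
    have h1 := convolution_congr (L := ContinuousLinearMap.lsmul ℝ ℝ) (μ := volume)
      (EventuallyEq.refl _ φ) (Lp.coeFn_add f g)
    rw [h1]
    filter_upwards [ae_convolutionExistsAt hφ (Lp.memLp f),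
      ae_convolutionExistsAt hφ (Lp.memLp g)] with x hf hg
    exact hf.distrib_add hg
  · rw [Lp.norm_toLp, Lp.norm_def, ← ENNReal.toReal_mul]
    exact ENNReal.toReal_mono (ENNReal.mul_ne_top (memLp_one_iff_integrable.2 hφ).2.ne
      (Lp.eLpNorm_ne_top f)) (eLpNorm_convolution_le hφ.1 (Lp.memLp f).1)

theorem continuous_toLp_bounded_mul {m : Rn n → ℂ} (hm : AEStronglyMeasurable m volume) {c : ℝ}
    (hc : ∀ ξ, ‖m ξ‖ ≤ c) :
    Continuous fun f : L2 n => ((memLp_bounded_mul hm hc (Lp.memLp f)).toLp _ : L2 n) := by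
  refine continuous_of_map_add_of_norm_le (c := c) (fun f g => ?_) fun f => ?_
  · rw [← MemLp.toLp_add, MemLp.toLp_eq_toLp_iff]
    filter_upwards [Lp.coeFn_add f g] with x hx
    rw [hx]
    exact mul_add _ _ _
  · refine Lp.norm_le_mul_norm_of_ae_le_mul ?_
    filter_upwards [(memLp_bounded_mul hm hc (Lp.memLp f)).coeFn_toLp] with x hx
    rw [hx, norm_mul]
    exact mul_le_mul_of_nonneg_right (hc x) (norm_nonneg _)

/-- For Schwartz `g` the convolution lies in `L¹ ∩ L²`, so the integral form of the convolution
theorem applies. -/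
theorem fourier_toLp_convolution_schwartz {φ : Rn n → ℝ} (hφ : Integrable φ volume)
    (g : SchwartzMap (Rn n) ℂ) {f : L2 n} (hf : g.toLp 2 = f) :
    (𝓕 ((memLp_convolution hφ (Lp.memLp f)).toLp _ : L2 n) : L2 n) =ᵐ[volume]
      fun ξ => kernelHat φ ξ * (𝓕 f : L2 n) ξ := by
  have hgL : f =ᵐ[volume] g := by
    rw [← hf]
    exact g.coeFn_toLp 2
  have hconv := convolution_congr (L := ContinuousLinearMap.lsmul ℝ ℝ) (μ := volume)
    (EventuallyEq.refl _ φ) hgL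
  have hint : Integrable (φ ⋆[ContinuousLinearMap.lsmul ℝ ℝ, volume] g) volume :=
    hφ.integrable_convolution _ g.integrable
  have hmem : MemLp (φ ⋆[ContinuousLinearMap.lsmul ℝ ℝ, volume] g) 2 volume :=
    memLp_convolution hφ (g.memLp 2)
  have h1 : ((memLp_convolution hφ (Lp.memLp f)).toLp _ : L2 n) = hmem.toLp _ := by
    rw [MemLp.toLp_eq_toLp_iff, hconv]
  have h2 : (𝓕 f : L2 n) =ᵐ[volume] (𝓕 g : SchwartzMap (Rn n) ℂ) := by
    rw [← hf, SchwartzMap.toLp_fourier_eq]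
    exact (𝓕 g : SchwartzMap (Rn n) ℂ).coeFn_toLp 2
  rw [h1]
  refine (fourier_toLp_ae_eq hint hmem).trans ?_
  filter_upwards [h2] with ξ hξ
  have h3 := Real.fourier_mul_convolution_eq (R := ℂ) hφ.ofReal (g.integrable (μ := volume)) ξ
  rw [hξ, convolution_lsmul_eq_mul, SchwartzMap.fourier_coe]
  exact h3

/-- The convolution theorem for an `L¹` kernel and an `L²` function. -/
theorem fourier_convolution_ae_eq {φ : Rn n → ℝ} (hφ : Integrable φ volume) (f : L2 n) :
    (𝓕 ((memLp_convolution hφ (Lp.memLp f)).toLp _ : L2 n) : L2 n) =ᵐ[volume]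
      fun ξ => kernelHat φ ξ * (𝓕 f : L2 n) ξ := by
  have hK := (continuous_kernelHat hφ).aestronglyMeasurable (μ := volume)
  suffices h : (𝓕 ((memLp_convolution hφ (Lp.memLp f)).toLp _ : L2 n) : L2 n) =
      (memLp_bounded_mul hK (norm_kernelHat_le φ) (Lp.memLp (𝓕 f : L2 n))).toLp _ by
    rw [h]
    exact MemLp.coeFn_toLp _
  -- Schwartz functions are dense and both sides are continuous in `f`, so the identity extends to
  -- all of `L²`.
  refine (SchwartzMap.denseRange_toLpCLM (E := Rn n) (F := ℂ) (μ := (volume : Measure (Rn n)))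
    (p := 2) ENNReal.ofNat_ne_top).induction_on (p := fun f : L2 n =>
    (𝓕 ((memLp_convolution hφ (Lp.memLp f)).toLp _ : L2 n) : L2 n) =
      (memLp_bounded_mul hK (norm_kernelHat_le φ) (Lp.memLp (𝓕 f : L2 n))).toLp _) f ?_ fun g => ?_
  · exact isClosed_eq
      ((Lp.fourierTransformₗᵢ (Rn n) ℂ).continuous.comp (continuous_toLp_convolution hφ))
      ((continuous_toLp_bounded_mul hK (norm_kernelHat_le φ)).comp
        (Lp.fourierTransformₗᵢ (Rn n) ℂ).continuous)
  · exact Lp.ext ((fourier_toLp_convolution_schwartz hφ g rfl).trans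
      (MemLp.coeFn_toLp _).symm)

theorem kernelHat_scaledKernel (φ : Rn n → ℝ) {β : ℝ} (hβ : 0 < β) (ξ : Rn n) :
    kernelHat (scaledKernel φ β) ξ = kernelHat φ (β • ξ) := by
  rw [kernelHat, kernelHat, Real.fourier_eq, Real.fourier_eq]
  have h := Measure.integral_comp_smul (volume : Measure (Rn n))
    (fun x => Real.fourierChar (-inner ℝ x (β • ξ)) • (φ x : ℂ)) β⁻¹
  rw [finrank_euclideanSpace_fin] at h
  have h2 : |((β⁻¹) ^ n)⁻¹| = β ^ n := by
    rw [inv_pow, inv_inv, abs_of_pos (pow_pos hβ n)]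
  rw [h2] at h
  have h3 : ∫ x, Real.fourierChar (-inner ℝ x (β • ξ)) • (φ x : ℂ) =
      ((1 / β ^ n : ℝ) : ℂ) • ∫ x, Real.fourierChar (-inner ℝ (β⁻¹ • x) (β • ξ)) •
        (φ (β⁻¹ • x) : ℂ) := by
    rw [h, Complex.coe_smul, smul_smul, one_div_mul_cancel (pow_pos hβ n).ne', one_smul]
  rw [h3, ← integral_smul]
  refine integral_congr_ae (Eventually.of_forall fun x => ?_)
  simp only [scaledKernel, inner_smul_left, inner_smul_right, Complex.ofReal_mul, map_inv₀,
    conj_trivial]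
  rw [mul_inv_cancel_left₀ hβ.ne', smul_comm, smul_eq_mul]

theorem integrable_scaledKernel {φ : Rn n → ℝ} (hφ : Integrable φ volume) {β : ℝ} (hβ : 0 < β) :
    Integrable (scaledKernel φ β) volume :=
  (hφ.comp_smul (inv_ne_zero hβ.ne')).const_mul _

theorem fourier_mollify_ae_eq {φ : Rn n → ℝ} (hφ : Integrable φ volume) {β : ℝ} (hβ : 0 < β)
    (f : L2 n) :
    (𝓕 (mollify φ β f) : L2 n) =ᵐ[volume] fun ξ => kernelHat φ (β • ξ) * (𝓕 f : L2 n) ξ := by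
  rw [mollify_eq (integrable_scaledKernel hφ hβ)]
  filter_upwards [fourier_convolution_ae_eq (integrable_scaledKernel hφ hβ) f] with ξ hξ
  rw [hξ, kernelHat_scaledKernel φ hβ]

/-! ### Bounds on `ψ` -/

section Symbols

theorem continuous_fracSymbol {τ : ℝ} (hτ : 0 < τ) : Continuous (fracSymbol τ : Rn n → ℝ) :=
  (continuous_const_smul _).norm.rpow_const fun _ => Or.inr (by positivity)

theorem fracSymbol_nonneg (τ : ℝ) (ξ : Rn n) : 0 ≤ fracSymbol τ ξ :=
  Real.rpow_nonneg (norm_nonneg _) _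

theorem fracSymbol_eq (τ : ℝ) (ξ : Rn n) : fracSymbol τ ξ = (2 * Real.pi * ‖ξ‖) ^ (2 * τ) := by
  rw [fracSymbol, norm_smul, Real.norm_of_nonneg Real.two_pi_pos.le]

variable {τ T : ℝ} {γ : ℝ → ℝ}

theorem integral_pos_of_pos_on_Ioo (hT : 0 < T) (hγ_pos : ∀ t ∈ Ioo 0 T, 0 < γ t)
    (hγ_int : IntegrableOn γ (Ioo 0 T) volume) : 0 < ∫ r in (0 : ℝ)..T, γ r :=
  intervalIntegral.intervalIntegral_pos_of_pos_on
    ((intervalIntegrable_iff_integrableOn_Ioo_of_le hT.le).2 hγ_int) hγ_pos hT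

theorem psi_pos (ξ : Rn n) : 0 < psi τ γ T ξ := Real.exp_pos _

theorem psi_le_one (hΓ : 0 < ∫ r in (0 : ℝ)..T, γ r) (ξ : Rn n) : psi τ γ T ξ ≤ 1 :=
  Real.exp_le_one_iff.2 (neg_nonpos.2 (mul_nonneg (fracSymbol_nonneg τ ξ) hΓ.le))

theorem abs_psi_le_one (hΓ : 0 < ∫ r in (0 : ℝ)..T, γ r) (ξ : Rn n) : |psi τ γ T ξ| ≤ 1 := by
  rw [abs_of_pos (psi_pos ξ)]
  exact psi_le_one hΓ ξ

theorem continuous_psi (hτ : 0 < τ) : Continuous (psi τ γ T : Rn n → ℝ) :=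
  Real.continuous_exp.comp ((continuous_fracSymbol hτ).mul continuous_const).neg

theorem exp_neg_le_psi (hτ : 0 < τ) (hΓ : 0 < ∫ r in (0 : ℝ)..T, γ r) {R : ℝ} {ξ : Rn n}
    (hξ : ‖ξ‖ ≤ R) :
    Real.exp (-((2 * Real.pi * R) ^ (2 * τ) * ∫ r in (0 : ℝ)..T, γ r)) ≤ psi τ γ T ξ := by
  rw [psi, fracSymbol_eq]
  gcongr

end Symbols

/-! ### Global bounds on `1 - φ̂` -/

section Kernel

variable {φ : Rn n → ℝ}

/-- Outside the ball where the local bound holds, the left side is at most `1 + ‖φ‖₁` and `‖ξ‖ ^ s`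
is bounded below. -/
theorem exists_norm_one_sub_kernelHat_le {s : ℝ} (hs : 0 < s)
    (hO : (fun ξ : Rn n => ‖1 - kernelHat φ ξ‖) =O[𝓝 0] fun ξ => ‖ξ‖ ^ s) :
    ∃ c : ℝ, 0 < c ∧ ∀ ξ : Rn n, ‖1 - kernelHat φ ξ‖ ≤ c * ‖ξ‖ ^ s := by
  obtain ⟨c, hc, h⟩ := hO.exists_pos
  obtain ⟨r, hr, h⟩ := Metric.eventually_nhds_iff.1 h.bound
  have hI : 0 ≤ ∫ x, ‖φ x‖ := integral_nonneg fun x => norm_nonneg _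
  have hrs : 0 < r ^ s := Real.rpow_pos_of_pos hr s
  refine ⟨max c ((1 + ∫ x, ‖φ x‖) / r ^ s), lt_max_of_lt_left hc, fun ξ => ?_⟩
  have hξs : 0 ≤ ‖ξ‖ ^ s := Real.rpow_nonneg (norm_nonneg _) _
  rcases lt_or_ge ‖ξ‖ r with hξ | hξ
  · have := h (y := ξ) (by simpa using hξ)
    rw [norm_norm, Real.norm_of_nonneg hξs] at this
    exact this.trans (mul_le_mul_of_nonneg_right (le_max_left _ _) hξs)
  · calc ‖1 - kernelHat φ ξ‖ ≤ 1 + ∫ x, ‖φ x‖ := by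
          refine (norm_sub_le _ _).trans ?_
          rw [norm_one]
          gcongr
          exact norm_kernelHat_le φ ξ
      _ = (1 + ∫ x, ‖φ x‖) / r ^ s * r ^ s := by field_simp
      _ ≤ (1 + ∫ x, ‖φ x‖) / r ^ s * ‖ξ‖ ^ s := by gcongr
      _ ≤ _ := mul_le_mul_of_nonneg_right (le_max_right _ _) hξs

theorem tendsto_kernelHat_cocompact (φ : Rn n → ℝ) :
    Tendsto (kernelHat φ) (cocompact (Rn n)) (𝓝 0) :=
  tendsto_integral_exp_inner_smul_cocompact _

/-- Three regions: near 0 the order condition applies; far out `φ̂ → 0` by Riemann–Lebesgue; on the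
compact set between, `|φ̂| < 1` keeps the continuous function away from 0. -/
theorem exists_le_norm_one_sub_kernelHat {s : ℝ} (hφ : Integrable φ volume)
    (hφ_lt : ∀ ξ : Rn n, ξ ≠ 0 → ‖kernelHat φ ξ‖ < 1)
    (hO : (fun ξ : Rn n => ‖ξ‖ ^ s) =O[𝓝 0] fun ξ => ‖1 - kernelHat φ ξ‖) :
    ∃ c : ℝ, 0 < c ∧ ∀ ξ : Rn n, c * min 1 (‖ξ‖ ^ s) ≤ ‖1 - kernelHat φ ξ‖ := by
  obtain ⟨c, hc, h⟩ := hO.exists_pos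
  obtain ⟨r, hr, h⟩ := Metric.eventually_nhds_iff.1 h.bound
  have hfar : ∀ᶠ ξ in cocompact (Rn n), 1 / 2 ≤ ‖1 - kernelHat φ ξ‖ := by
    have := ((tendsto_kernelHat_cocompact φ).const_sub 1).norm
    rw [sub_zero, norm_one] at this
    filter_upwards [this.eventually (lt_mem_nhds (by norm_num : (1 / 2 : ℝ) < 1))] with ξ hξ
    exact hξ.le
  obtain ⟨K, hK, hKfar⟩ := mem_cocompact.1 hfar
  have hcompact : IsCompact (K \ Metric.ball 0 r) := hK.diff Metric.isOpen_ball
  obtain ⟨d, hd, hmid⟩ : ∃ d : ℝ, 0 < d ∧ ∀ ξ ∈ K \ Metric.ball 0 r,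
      d ≤ ‖1 - kernelHat φ ξ‖ := by
    rcases (K \ Metric.ball 0 r).eq_empty_or_nonempty with he | hne
    · exact ⟨1, one_pos, fun ξ hξ => by simp [he] at hξ⟩
    · obtain ⟨ξ₀, hξ₀, hmin⟩ := hcompact.exists_isMinOn hne
        (continuous_const.sub (continuous_kernelHat hφ)).norm.continuousOn
      refine ⟨_, norm_pos_iff.2 fun h0 => ?_, fun ξ hξ => hmin hξ⟩
      have hne0 : ξ₀ ≠ 0 := fun h1 => hξ₀.2 (by simpa [h1] using hr)
      have := hφ_lt ξ₀ hne0
      rw [← sub_eq_zero.1 h0, norm_one] at this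
      exact this.false
  have hm0 : ∀ ξ : Rn n, 0 ≤ min 1 (‖ξ‖ ^ s) := fun ξ =>
    le_min zero_le_one (Real.rpow_nonneg (norm_nonneg _) _)
  refine ⟨min (1 / c) (min (1 / 2) d), by positivity, fun ξ => ?_⟩
  by_cases hξ : ξ ∈ Metric.ball (0 : Rn n) r
  · have h1 := h (y := ξ) (by simpa using hξ)
    rw [norm_norm, Real.norm_of_nonneg (Real.rpow_nonneg (norm_nonneg _) _)] at h1
    calc _ ≤ 1 / c * ‖ξ‖ ^ s :=
          mul_le_mul (min_le_left _ _) (min_le_right _ _) (hm0 ξ) (by positivity)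
      _ ≤ _ := by
          rw [one_div, inv_mul_le_iff₀ hc]
          exact h1
  · have h2 : min (1 / 2) d ≤ ‖1 - kernelHat φ ξ‖ := by
      by_cases hξK : ξ ∈ K
      · exact (min_le_right _ _).trans (hmid ξ ⟨hξK, hξ⟩)
      · exact (min_le_left _ _).trans (hKfar hξK)
    calc _ ≤ min (1 / 2) d * 1 :=
          mul_le_mul (min_le_right _ _) (min_le_left _ _) (hm0 ξ) (by positivity)
      _ ≤ _ := by rwa [mul_one]

end Kernel

/-- The symbol `ψ² + |1 - φ̂(β ·)|²` of the normal operator of `J_β`. -/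
noncomputable def normalSymbol (τ : ℝ) (γ : ℝ → ℝ) (T : ℝ) (φ : Rn n → ℝ) (β : ℝ) (ξ : Rn n) : ℝ :=
  psi τ γ T ξ ^ 2 + ‖1 - kernelHat φ (β • ξ)‖ ^ 2

/-! ### Noise amplification -/

section NormalSymbol

variable {τ T β : ℝ} {γ : ℝ → ℝ} {φ : Rn n → ℝ}

theorem normalSymbol_pos (ξ : Rn n) : 0 < normalSymbol τ γ T φ β ξ :=
  add_pos_of_pos_of_nonneg (pow_pos (psi_pos ξ) 2) (sq_nonneg _)

theorem continuous_normalSymbol (hτ : 0 < τ) (hφ : Integrable φ volume) :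
    Continuous (normalSymbol τ γ T φ β) :=
  ((continuous_psi hτ).pow 2).add (((continuous_const.sub
    ((continuous_kernelHat hφ).comp (continuous_const_smul β))).norm).pow 2)

/-- The noise amplification factor of the regularisation. -/
theorem exists_psi_div_normalSymbol_le {s : ℝ} (hs : 0 < s) (hτ : 0 < τ)
    (hΓ : 0 < ∫ r in (0 : ℝ)..T, γ r) (hφ : Integrable φ volume)
    (hφ_lt : ∀ ξ : Rn n, ξ ≠ 0 → ‖kernelHat φ ξ‖ < 1)
    (hO : (fun ξ : Rn n => ‖ξ‖ ^ s) =O[𝓝 0] fun ξ => ‖1 - kernelHat φ ξ‖) :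
    ∃ c : ℝ, 0 < c ∧ ∀ β : ℝ, 0 < β → ∀ ξ : Rn n,
      psi τ γ T ξ / normalSymbol τ γ T φ β ξ ≤ c / min 1 (β ^ s) := by
  obtain ⟨c, hc, h⟩ := exists_le_norm_one_sub_kernelHat hφ hφ_lt hO
  set P := Real.exp (-((2 * Real.pi * 1) ^ (2 * τ) * ∫ r in (0 : ℝ)..T, γ r)) with hP
  have hP0 : 0 < P := Real.exp_pos _
  refine ⟨max (1 / P) (1 / c), by positivity, fun β hβ ξ => ?_⟩
  have hβs : 0 < β ^ s := Real.rpow_pos_of_pos hβ s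
  have hm : 0 < min 1 (β ^ s) := lt_min one_pos hβs
  have hψ := psi_pos (τ := τ) (γ := γ) (T := T) ξ
  have hN := normalSymbol_pos (τ := τ) (γ := γ) (T := T) (φ := φ) (β := β) ξ
  rcases le_total ‖ξ‖ 1 with hξ | hξ
  · have h1 : P ≤ psi τ γ T ξ := exp_neg_le_psi hτ hΓ hξ
    calc _ ≤ 1 / psi τ γ T ξ := by
          rw [div_le_div_iff₀ hN hψ, normalSymbol]
          nlinarith [sq_nonneg ‖1 - kernelHat φ (β • ξ)‖]
      _ ≤ 1 / P := by gcongr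
      _ ≤ max (1 / P) (1 / c) := le_max_left _ _
      _ ≤ _ := le_div_self (by positivity) hm (min_le_left _ _)
  · have h1 : c * min 1 (β ^ s) ≤ ‖1 - kernelHat φ (β • ξ)‖ := by
      refine le_trans ?_ (h (β • ξ))
      rw [norm_smul, Real.norm_of_nonneg hβ.le]
      gcongr
      exact le_mul_of_one_le_right hβ.le hξ
    have ha : 0 < ‖1 - kernelHat φ (β • ξ)‖ := lt_of_lt_of_le (by positivity) h1
    -- With `a = |1 - φ̂(βξ)|`, this is `ψ a ≤ ψ² + a²`.
    calc _ ≤ 1 / ‖1 - kernelHat φ (β • ξ)‖ := by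
          rw [div_le_div_iff₀ hN ha, normalSymbol]
          nlinarith [sq_nonneg (psi τ γ T ξ - ‖1 - kernelHat φ (β • ξ)‖)]
      _ ≤ 1 / (c * min 1 (β ^ s)) := by gcongr
      _ = (1 / c) / min 1 (β ^ s) := by field_simp
      _ ≤ _ := by gcongr; exact le_max_right _ _

end NormalSymbol

/-! ### The minimiser of `J_β` -/

section Minimiser

variable {τ T β : ℝ} {γ : ℝ → ℝ} {φ : Rn n → ℝ}

theorem complete_square (a : ℝ) (ha : 0 < a) (b V H : ℂ) :
    ‖(a : ℂ) * V - H‖ ^ 2 + ‖b * V‖ ^ 2 =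
      (a ^ 2 + ‖b‖ ^ 2) * ‖V - ((a / (a ^ 2 + ‖b‖ ^ 2) : ℝ) : ℂ) * H‖ ^ 2 +
        ‖b‖ ^ 2 / (a ^ 2 + ‖b‖ ^ 2) * ‖H‖ ^ 2 := by
  have hN : 0 < a ^ 2 + ‖b‖ ^ 2 := by positivity
  set N := a ^ 2 + ‖b‖ ^ 2 with hNdef
  have hb : ‖b‖ ^ 2 = N - a ^ 2 := by rw [hNdef]; ring
  rw [norm_mul, mul_pow, hb]
  simp only [← Complex.normSq_eq_norm_sq, Complex.normSq_apply, Complex.sub_re, Complex.sub_im,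
    Complex.re_ofReal_mul, Complex.im_ofReal_mul]
  field_simp
  ring

theorem integrable_bounded_mul_norm_sq {F : Rn n → ℂ} (hF : MemLp F 2 volume) {m : Rn n → ℝ}
    (hm : Continuous m) {c : ℝ} (hc : ∀ ξ, |m ξ| ≤ c) :
    Integrable (fun ξ => m ξ * ‖F ξ‖ ^ 2) volume :=
  ((memLp_two_iff_integrable_sq_norm hF.1).1 hF).bdd_mul hm.aestronglyMeasurable
    (Eventually.of_forall hc)

theorem functionalJ_eq_integral (hτ : 0 < τ) (hΓ : 0 < ∫ r in (0 : ℝ)..T, γ r)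
    (hφ : Integrable φ volume) (hβ : 0 < β) (h v : L2 n) :
    functionalJ τ γ T φ β h v = ∫ ξ, (‖(psi τ γ T ξ : ℂ) * (𝓕 v : L2 n) ξ - (𝓕 h : L2 n) ξ‖ ^ 2 +
      ‖(1 - kernelHat φ (β • ξ)) * (𝓕 v : L2 n) ξ‖ ^ 2) := by
  have h1 : (𝓕 (opA τ γ T v - h) : L2 n) =ᵐ[volume]
      fun ξ => (psi τ γ T ξ : ℂ) * (𝓕 v : L2 n) ξ - (𝓕 h : L2 n) ξ := by
    filter_upwards [fourier_sub_ae (opA τ γ T v) h,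
      fourier_fourierMul (continuous_psi hτ).measurable (abs_psi_le_one hΓ) v] with ξ h2 h3
    rw [h2, opA, h3]
  have h2 : (𝓕 (v - mollify φ β v) : L2 n) =ᵐ[volume]
      fun ξ => (1 - kernelHat φ (β • ξ)) * (𝓕 v : L2 n) ξ := by
    filter_upwards [fourier_sub_ae v (mollify φ β v), fourier_mollify_ae_eq hφ hβ v] with ξ h3 h4
    rw [h3, h4, sub_mul, one_mul]
  have i1 := (memLp_two_iff_integrable_sq_norm (Lp.memLp (𝓕 (opA τ γ T v - h) : L2 n)).1).1
    (Lp.memLp _)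
  have i2 := (memLp_two_iff_integrable_sq_norm (Lp.memLp (𝓕 (v - mollify φ β v) : L2 n)).1).1
    (Lp.memLp _)
  rw [functionalJ, norm_sq_eq_integral_fourier, norm_sq_eq_integral_fourier, ← integral_add i1 i2]
  refine integral_congr_ae ?_
  filter_upwards [h1, h2] with ξ h3 h4
  rw [h3, h4]

theorem normalSymbol_le (hΓ : 0 < ∫ r in (0 : ℝ)..T, γ r) (ξ : Rn n) :
    normalSymbol τ γ T φ β ξ ≤ 1 + (1 + ∫ x, ‖φ x‖) ^ 2 := by
  have h1 : ‖1 - kernelHat φ (β • ξ)‖ ≤ 1 + ∫ x, ‖φ x‖ := by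
    refine (norm_sub_le _ _).trans ?_
    rw [norm_one]
    gcongr
    exact norm_kernelHat_le φ _
  have h2 := psi_le_one (τ := τ) hΓ ξ
  have h3 := (psi_pos (τ := τ) (γ := γ) (T := T) ξ).le
  rw [normalSymbol]
  gcongr
  exact pow_le_one₀ h3 h2

/-- The integrated completed square: only the first integral depends on `v`, and it vanishes at `v =
w`. -/
theorem functionalJ_eq (hτ : 0 < τ) (hΓ : 0 < ∫ r in (0 : ℝ)..T, γ r)
    (hφ : Integrable φ volume) (hβ : 0 < β) {h w : L2 n}
    (hw : (𝓕 w : L2 n) =ᵐ[volume]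
      fun ξ => ((psi τ γ T ξ / normalSymbol τ γ T φ β ξ : ℝ) : ℂ) * (𝓕 h : L2 n) ξ) (v : L2 n) :
    functionalJ τ γ T φ β h v =
      (∫ ξ, normalSymbol τ γ T φ β ξ * ‖(𝓕 (v - w) : L2 n) ξ‖ ^ 2) +
        ∫ ξ, ‖1 - kernelHat φ (β • ξ)‖ ^ 2 / normalSymbol τ γ T φ β ξ * ‖(𝓕 h : L2 n) ξ‖ ^ 2 := by
  have hb : Continuous fun ξ : Rn n => ‖1 - kernelHat φ (β • ξ)‖ ^ 2 :=
    (continuous_const.sub ((continuous_kernelHat hφ).comp (continuous_const_smul β))).norm.pow 2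
  have hN := continuous_normalSymbol (β := β) (γ := γ) (T := T) hτ hφ
  have i1 := integrable_bounded_mul_norm_sq (Lp.memLp (𝓕 (v - w) : L2 n)) hN
    (c := 1 + (1 + ∫ x, ‖φ x‖) ^ 2) fun ξ => by
      rw [abs_of_pos (normalSymbol_pos ξ)]
      exact normalSymbol_le hΓ ξ
  have i2 := integrable_bounded_mul_norm_sq (Lp.memLp (𝓕 h : L2 n))
    (m := fun ξ => ‖1 - kernelHat φ (β • ξ)‖ ^ 2 / normalSymbol τ γ T φ β ξ)
    (hb.div hN fun ξ => (normalSymbol_pos ξ).ne') (c := 1) fun ξ => by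
      rw [abs_of_nonneg (div_nonneg (sq_nonneg _) (normalSymbol_pos ξ).le),
        div_le_one (normalSymbol_pos ξ), normalSymbol]
      exact le_add_of_nonneg_left (sq_nonneg _)
  rw [functionalJ_eq_integral hτ hΓ hφ hβ, ← integral_add i1 i2]
  refine integral_congr_ae ?_
  filter_upwards [hw, fourier_sub_ae v w] with ξ h1 h2
  rw [h2, h1]
  exact complete_square _ (psi_pos ξ) _ _ _

theorem exists_fourier_eq_psi_div_normalSymbol_mul {s : ℝ} (hs : 0 < s) (hτ : 0 < τ)
    (hΓ : 0 < ∫ r in (0 : ℝ)..T, γ r) (hφ : Integrable φ volume)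
    (hφ_lt : ∀ ξ : Rn n, ξ ≠ 0 → ‖kernelHat φ ξ‖ < 1)
    (hO : (fun ξ : Rn n => ‖ξ‖ ^ s) =O[𝓝 0] fun ξ => ‖1 - kernelHat φ ξ‖)
    (hβ : 0 < β) (h : L2 n) :
    ∃ w : L2 n, (𝓕 w : L2 n) =ᵐ[volume]
      fun ξ => ((psi τ γ T ξ / normalSymbol τ γ T φ β ξ : ℝ) : ℂ) * (𝓕 h : L2 n) ξ := by
  obtain ⟨c, hc, hle⟩ := exists_psi_div_normalSymbol_le (T := T) (γ := γ) hs hτ hΓ hφ hφ_lt hO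
  refine exists_fourier_ae_eq (memLp_bounded_mul (c := c / min 1 (β ^ s)) ?_ (fun ξ => ?_)
    (Lp.memLp _))
  · exact (Complex.continuous_ofReal.comp ((continuous_psi hτ).div
      (continuous_normalSymbol hτ hφ) fun ξ => (normalSymbol_pos ξ).ne')).aestronglyMeasurable
  · rw [Complex.norm_real, Real.norm_of_nonneg (div_nonneg (psi_pos ξ).le (normalSymbol_pos ξ).le)]
    exact hle β hβ ξ

theorem isRegularizedSolution_iff (hτ : 0 < τ) (hΓ : 0 < ∫ r in (0 : ℝ)..T, γ r)
    (hφ : Integrable φ volume) (hβ : 0 < β) {h w : L2 n}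
    (hw : (𝓕 w : L2 n) =ᵐ[volume]
      fun ξ => ((psi τ γ T ξ / normalSymbol τ γ T φ β ξ : ℝ) : ℂ) * (𝓕 h : L2 n) ξ) (v : L2 n) :
    IsRegularizedSolution τ γ T φ β h v ↔ v = w := by
  have hJ := functionalJ_eq hτ hΓ hφ hβ hw
  have h0 : ∀ u : L2 n, 0 ≤ᵐ[volume] fun ξ : Rn n =>
      normalSymbol τ γ T φ β ξ * ‖(𝓕 (u - w) : L2 n) ξ‖ ^ 2 := fun u =>
    Eventually.of_forall fun ξ => mul_nonneg (normalSymbol_pos ξ).le (sq_nonneg _)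
  have hzero : ∫ ξ, normalSymbol τ γ T φ β ξ * ‖(𝓕 (w - w) : L2 n) ξ‖ ^ 2 = 0 := by
    refine integral_eq_zero_of_ae ?_
    filter_upwards [fourier_sub_ae w w] with ξ hξ
    rw [hξ]
    simp
  constructor
  · intro hv
    have h1 : functionalJ τ γ T φ β h v ≤ functionalJ τ γ T φ β h w := hv (mem_univ w)
    rw [hJ v, hJ w, hzero] at h1
    have h2 : ∫ ξ, normalSymbol τ γ T φ β ξ * ‖(𝓕 (v - w) : L2 n) ξ‖ ^ 2 = 0 :=
      le_antisymm (by linarith) (integral_nonneg_of_ae (h0 v))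
    rw [integral_eq_zero_iff_of_nonneg_ae (h0 v)] at h2
    · refine eq_of_fourier_ae_eq ?_
      filter_upwards [h2, fourier_sub_ae v w] with ξ h3 h4
      have h5 : (𝓕 (v - w) : L2 n) ξ = 0 := by
        simpa [(normalSymbol_pos (τ := τ) (γ := γ) (T := T) (φ := φ) (β := β) ξ).ne'] using h3
      rw [h4] at h5
      exact sub_eq_zero.1 h5
    · exact integrable_bounded_mul_norm_sq (Lp.memLp (𝓕 (v - w) : L2 n))
        (continuous_normalSymbol hτ hφ) (c := 1 + (1 + ∫ x, ‖φ x‖) ^ 2) fun ξ => by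
          rw [abs_of_pos (normalSymbol_pos ξ)]
          exact normalSymbol_le hΓ ξ
  · rintro rfl u -
    change functionalJ τ γ T φ β h v ≤ functionalJ τ γ T φ β h u
    rw [hJ v, hJ u, hzero]
    exact add_le_add_left (integral_nonneg_of_ae (h0 u)) _

end Minimiser

end BackwardHeat

/-! ### Absolute continuity under composition -/

theorem LipschitzOnWith.comp_absolutelyContinuousOnInterval {X Y : Type*} [PseudoMetricSpace X]
    [PseudoMetricSpace Y] {K : NNReal} {F : X → Y} {s : Set X} {f : ℝ → X} {a b : ℝ}
    (hF : LipschitzOnWith K F s) (hf : AbsolutelyContinuousOnInterval f a b)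
    (hs : MapsTo f (uIcc a b) s) : AbsolutelyContinuousOnInterval (F ∘ f) a b := by
  unfold AbsolutelyContinuousOnInterval at hf ⊢
  refine squeeze_zero' (Eventually.of_forall fun _ => Finset.sum_nonneg fun i _ => dist_nonneg) ?_
    (by simpa using hf.const_mul (K : ℝ))
  rw [eventually_inf_principal]
  refine Eventually.of_forall fun E hE => ?_
  rw [Finset.mul_sum]
  exact Finset.sum_le_sum fun i hi =>
    hF.dist_le_mul _ (hs (hE.1 i hi).1) _ (hs (hE.1 i hi).2)

/-- The range of `f` is bounded, and `exp` is Lipschitz on bounded intervals. -/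
theorem AbsolutelyContinuousOnInterval.exp {f : ℝ → ℝ} {a b : ℝ}
    (hf : AbsolutelyContinuousOnInterval f a b) :
    AbsolutelyContinuousOnInterval (fun t => Real.exp (f t)) a b := by
  obtain ⟨C, hC⟩ := hf.exists_bound
  obtain ⟨K, hK⟩ := (Real.contDiff_exp (n := 1)).contDiffOn.exists_lipschitzOnWith one_ne_zero
    (convex_Icc (-C) C) isCompact_Icc
  exact hK.comp_absolutelyContinuousOnInterval hf fun t ht => abs_le.1 (hC t ht)

namespace BackwardHeat

variable {n : ℕ}

/-! ### The final value of a solution -/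

section Flow

/-- Carathéodory solutions of the scalar linear equation `y' = -k y` with `k ∈ L¹`. -/
theorem eq_exp_neg_integral_mul {k y : ℝ → ℝ} {T : ℝ} (hT : 0 ≤ T)
    (hk : IntervalIntegrable k volume 0 T) (hy : ContinuousOn y (Icc 0 T))
    (h : ∀ t ∈ Icc 0 T, y t = y 0 - ∫ r in (0 : ℝ)..t, k r * y r) :
    y T = Real.exp (-∫ r in (0 : ℝ)..T, k r) * y 0 := by
  have hI : uIcc 0 T = Icc 0 T := uIcc_of_le hT
  have h0 : (0 : ℝ) ∈ uIcc 0 T := left_mem_uIcc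
  have hky : IntervalIntegrable (fun r => k r * y r) volume 0 T :=
    hk.mul_continuousOn (by rwa [hI])
  set G : ℝ → ℝ := fun t => ∫ r in (0 : ℝ)..t, k r with hG
  set Y : ℝ → ℝ := fun t => y 0 - ∫ r in (0 : ℝ)..t, k r * y r with hY
  have hGac : AbsolutelyContinuousOnInterval (fun t => Real.exp (G t)) 0 T :=
    (hk.absolutelyContinuousOnInterval_intervalIntegral h0).exp
  have hYac : AbsolutelyContinuousOnInterval Y 0 T :=
    (LipschitzWith.const (y 0)).lipschitzOnWith.absolutelyContinuousOnInterval.sub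
      (hky.absolutelyContinuousOnInterval_intervalIntegral h0)
  -- Integrating factor: `exp(G) Y` is absolutely continuous with derivative zero almost everywhere,
  -- hence constant. `Y` is used because its integral form gives absolute continuity; it agrees with
  -- `y` on `[0, T]`.
  have hderiv : ∀ᵐ t, t ∈ uIcc 0 T → HasDerivAt (fun t => Real.exp (G t) * Y t) 0 t := by
    filter_upwards [hk.ae_hasDerivAt_integral, hky.ae_hasDerivAt_integral] with t h1 h2 ht
    have h3 := (h1 ht 0 h0).exp.mul ((h2 ht 0 h0).const_sub (y 0))
    have h4 : y t = Y t := h t (hI ▸ ht)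
    refine h3.congr_deriv ?_
    change Real.exp (G t) * k t * Y t + Real.exp (G t) * -(k t * y t) = 0
    rw [h4]
    ring
  obtain ⟨C, hC⟩ := (hGac.fun_mul hYac).const_of_ae_hasDerivAt_zero hderiv
  have e0 := hC 0 h0
  have eT := hC T right_mem_uIcc
  have hG0 : G 0 = 0 := intervalIntegral.integral_same
  have hY0 : Y 0 = y 0 := by simp [hY]
  rw [hG0, Real.exp_zero, one_mul, hY0] at e0
  have hYT : y T = Y T := h T (right_mem_Icc.2 hT)
  rw [e0, ← eT, ← hYT, ← mul_assoc, ← Real.exp_add, neg_add_cancel, Real.exp_zero, one_mul]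

theorem eq_exp_neg_integral_mul_complex {k : ℝ → ℝ} {y : ℝ → ℂ} {T : ℝ} (hT : 0 ≤ T)
    (hk : IntervalIntegrable k volume 0 T) (hy : ContinuousOn y (Icc 0 T))
    (h : ∀ t ∈ Icc 0 T, y t = y 0 - ∫ r in (0 : ℝ)..t, (k r : ℂ) * y r) :
    y T = (Real.exp (-∫ r in (0 : ℝ)..T, k r) : ℂ) * y 0 := by
  -- As `k` is real, every real-linear functional of `y` solves the same equation; real and
  -- imaginary parts suffice.
  have key : ∀ L : ℂ →L[ℝ] ℝ, L (y T) = Real.exp (-∫ r in (0 : ℝ)..T, k r) * L (y 0) := by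
    intro L
    refine eq_exp_neg_integral_mul (y := fun t => L (y t)) hT hk (L.continuous.comp_continuousOn hy)
      fun t ht => ?_
    have hint : IntervalIntegrable (fun r => (k r : ℂ) * y r) volume 0 t := by
      refine IntervalIntegrable.mul_continuousOn ?_ (hy.mono ?_)
      · have h1 := hk.mono_set (uIcc_subset_uIcc_left (by rwa [uIcc_of_le hT]))
        exact ⟨h1.1.ofReal, h1.2.ofReal⟩
      · rw [uIcc_of_le ht.1]
        exact Icc_subset_Icc_right ht.2
    have h2 := L.intervalIntegral_comp_comm hint
    have h3 : ∀ r, L ((k r : ℂ) * y r) = k r * L (y r) := fun r => by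
      rw [← Complex.real_smul, map_smul, smul_eq_mul]
    simp only [h3] at h2
    rw [h2, ← map_sub, ← h t ht]
  apply Complex.ext
  · rw [Complex.re_ofReal_mul]
    exact key Complex.reCLM
  · rw [Complex.im_ofReal_mul]
    exact key Complex.imCLM

theorem IsSolution.fourier_ae_eq {τ T : ℝ} {γ : ℝ → ℝ} {u : ℝ → L2 n} (hu : IsSolution τ γ T u)
    (hT : 0 ≤ T) (hγ : IntervalIntegrable γ volume 0 T) :
    (𝓕 (u T) : L2 n) =ᵐ[volume] fun ξ => (psi τ γ T ξ : ℂ) * (𝓕 (u 0) : L2 n) ξ := by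
  obtain ⟨v, hv, hode⟩ := hu
  filter_upwards [hv 0 (left_mem_Icc.2 hT), hv T (right_mem_Icc.2 hT), hode] with ξ h0 hvT hξ
  rw [h0, hvT, eq_exp_neg_integral_mul_complex hT (hγ.mul_const _) hξ.1 hξ.2,
    intervalIntegral.integral_mul_const, psi, mul_comm (fracSymbol τ ξ)]

end Flow

/-! ### The logarithmic source condition -/

section Source

variable {τ T : ℝ} {γ : ℝ → ℝ}

/-- The factor `1/√e` adds 1 to `-ln ψ²`, so the base is at least 1 and the multiplier is bounded
even at `ξ = 0`. -/
theorem logRate_psi (q : ℝ) (ξ : Rn n) :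
    logRate q ((psi τ γ T ξ / Real.sqrt (Real.exp 1)) ^ 2) =
      (1 + 2 * (fracSymbol τ ξ * ∫ r in (0 : ℝ)..T, γ r)) ^ (-q) := by
  have h : (psi τ γ T ξ / Real.sqrt (Real.exp 1)) ^ 2 =
      Real.exp (-(1 + 2 * (fracSymbol τ ξ * ∫ r in (0 : ℝ)..T, γ r))) := by
    rw [div_pow, Real.sq_sqrt (Real.exp_pos 1).le, psi, ← Real.exp_nat_mul, ← Real.exp_sub]
    congr 1
    push_cast
    ring
  rw [logRate, h, Real.log_exp, neg_neg]

/-- From `|ξ|^{2τ} ≤ (1+|ξ|²)^τ`; the exponent `p/(2τ)` turns `(1+|ξ|²)^τ` into the Sobolev weight.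
-/
theorem one_add_fracSymbol_mul_rpow_le {p Γ : ℝ} (hτ : 0 < τ) (hp : 0 < p) (hΓ : 0 < Γ) (ξ : Rn n) :
    (1 + 2 * (fracSymbol τ ξ * Γ)) ^ (p / (2 * τ)) ≤
      (1 + 2 * ((2 * Real.pi) ^ (2 * τ) * Γ)) ^ (p / (2 * τ)) * (1 + ‖ξ‖ ^ 2) ^ (p / 2) := by
  have hr := norm_nonneg ξ
  have hπ := Real.two_pi_pos
  have hB : 0 < (2 * Real.pi) ^ (2 * τ) := Real.rpow_pos_of_pos hπ _
  have h1 : 1 ≤ (1 + ‖ξ‖ ^ 2) ^ τ := Real.one_le_rpow (by nlinarith) hτ.le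
  have h2 : ‖ξ‖ ^ (2 * τ) ≤ (1 + ‖ξ‖ ^ 2) ^ τ := by
    rw [Real.rpow_mul hr, Real.rpow_two]
    exact Real.rpow_le_rpow (sq_nonneg _) (by linarith) hτ.le
  have h3 : (1 + ‖ξ‖ ^ 2) ^ (p / 2) = ((1 + ‖ξ‖ ^ 2) ^ τ) ^ (p / (2 * τ)) := by
    rw [← Real.rpow_mul (by positivity)]
    congr 1
    field_simp
  have hf := fracSymbol_nonneg τ ξ
  rw [h3, ← Real.mul_rpow (by positivity) (by positivity)]
  refine Real.rpow_le_rpow (by positivity) ?_ (by positivity)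
  rw [fracSymbol_eq, Real.mul_rpow hπ.le hr, add_mul, one_mul]
  refine add_le_add h1 ?_
  calc _ = 2 * ((2 * Real.pi) ^ (2 * τ) * Γ) * ‖ξ‖ ^ (2 * τ) := by ring
    _ ≤ _ := by gcongr

/-- Functions in `H^p` satisfy a logarithmic source condition. -/
theorem exists_logSourceOp_eq {p : ℝ} (hτ : 0 < τ) (hp : 0 < p)
    (hΓ : 0 < ∫ r in (0 : ℝ)..T, γ r) :
    ∃ C : ℝ, 0 < C ∧ ∀ E : ℝ, 0 < E → ∀ f : L2 n, sobolevNorm p f ≤ ENNReal.ofReal E →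
      ∃ w : L2 n, f = logSourceOp τ γ T (p / (2 * τ)) w ∧ ‖w‖ ≤ C * E := by
  set Γ := ∫ r in (0 : ℝ)..T, γ r with hΓdef
  set q := p / (2 * τ) with hq
  have hq0 : 0 < q := by positivity
  have hπ := Real.two_pi_pos
  have hB : 0 < (2 * Real.pi) ^ (2 * τ) := Real.rpow_pos_of_pos hπ _
  have hpos : ∀ ξ : Rn n, 1 ≤ 1 + 2 * (fracSymbol τ ξ * Γ) := fun ξ => by
    have := mul_nonneg (fracSymbol_nonneg τ ξ) hΓ.le
    linarith
  have hcont : Continuous fun ξ : Rn n => 1 + 2 * (fracSymbol τ ξ * Γ) :=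
    continuous_const.add (((continuous_fracSymbol hτ).mul continuous_const).const_mul 2)
  have hcont_rpow : ∀ a : ℝ, Continuous fun ξ : Rn n => (1 + 2 * (fracSymbol τ ξ * Γ)) ^ a :=
    fun a => hcont.rpow_const fun ξ => Or.inl (zero_lt_one.trans_le (hpos ξ)).ne'
  refine ⟨(1 + 2 * ((2 * Real.pi) ^ (2 * τ) * Γ)) ^ q, by positivity, fun E hE f hf => ?_⟩
  set C := (1 + 2 * ((2 * Real.pi) ^ (2 * τ) * Γ)) ^ q with hC
  have hC0 : 0 < C := by positivity
  -- The transform of the source element: `f̂` divided by the symbol of `f_q(Ā*Ā)`.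
  set F : Rn n → ℂ := fun ξ => (((1 + 2 * (fracSymbol τ ξ * Γ)) ^ q : ℝ) : ℂ) * (𝓕 f : L2 n) ξ
    with hF
  have hFle : eLpNorm F 2 volume ≤ ENNReal.ofReal (C * E) := by
    rw [ENNReal.ofReal_mul hC0.le]
    refine le_trans ?_ (mul_le_mul_right hf _)
    refine eLpNorm_le_mul_eLpNorm_of_ae_le_mul (Eventually.of_forall fun ξ => ?_) 2
    have hw0 : 0 ≤ (1 + ‖ξ‖ ^ 2) ^ (p / 2) := by positivity
    rw [hF, norm_mul, norm_mul, Complex.norm_real, Complex.norm_real,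
      Real.norm_of_nonneg (Real.rpow_nonneg (zero_le_one.trans (hpos ξ)) _),
      Real.norm_of_nonneg hw0, ← mul_assoc C]
    exact mul_le_mul_of_nonneg_right (one_add_fracSymbol_mul_rpow_le hτ hp hΓ ξ)
      (norm_nonneg ((𝓕 f : L2 n) ξ))
  have hFm : MemLp F 2 volume :=
    ⟨(Complex.continuous_ofReal.comp (hcont_rpow q)).aestronglyMeasurable.mul (Lp.memLp _).1,
      hFle.trans_lt ENNReal.ofReal_lt_top⟩
  obtain ⟨w, hw⟩ := exists_fourier_ae_eq hFm
  refine ⟨w, eq_of_fourier_ae_eq ?_, ?_⟩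
  · have hmeas : Measurable fun ξ : Rn n =>
        logRate q ((psi τ γ T ξ / Real.sqrt (Real.exp 1)) ^ 2) := by
      simp_rw [logRate_psi]
      exact (hcont_rpow (-q)).measurable
    have hbd : ∀ ξ : Rn n, |logRate q ((psi τ γ T ξ / Real.sqrt (Real.exp 1)) ^ 2)| ≤ 1 := by
      intro ξ
      rw [logRate_psi, abs_of_nonneg (Real.rpow_nonneg (zero_le_one.trans (hpos ξ)) _)]
      exact Real.rpow_le_one_of_one_le_of_nonpos (hpos ξ) (by linarith)
    filter_upwards [fourier_fourierMul hmeas hbd w, hw] with ξ h1 h2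
    rw [logSourceOp, h1, h2, hF, logRate_psi, ← mul_assoc, ← Complex.ofReal_mul,
      ← Real.rpow_add (zero_lt_one.trans_le (hpos ξ)), neg_add_cancel, Real.rpow_zero,
      Complex.ofReal_one, one_mul]
  · rw [← ENNReal.ofReal_le_ofReal_iff (by positivity), ofReal_norm_eq_eLpNorm_fourier,
      eLpNorm_congr_ae hw]
    exact hFle

end Source

/-! ### Bias -/

section Bias

variable {τ T : ℝ} {γ : ℝ → ℝ} {φ : Rn n → ℝ}

/-- The bias of the regularisation on `H^p`, in terms of `L = -log β`. -/
theorem exists_sq_div_normalSymbol_le {p s : ℝ} (hτ : 0 < τ) (hp : 0 < p) (hs : 0 < s)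
    (hΓ : 0 < ∫ r in (0 : ℝ)..T, γ r)
    (hO : (fun ξ : Rn n => ‖1 - kernelHat φ ξ‖) =O[𝓝 0] fun ξ => ‖ξ‖ ^ s) :
    ∃ c : ℝ, 0 < c ∧ ∀ᶠ L in atTop, ∀ ξ : Rn n,
      ‖1 - kernelHat φ (Real.exp (-L) • ξ)‖ ^ 2 / normalSymbol τ γ T φ (Real.exp (-L)) ξ ≤
        c * L ^ (-(p / (2 * τ))) * (1 + ‖ξ‖ ^ 2) ^ (p / 2) := by
  obtain ⟨c, hc, hle⟩ := exists_norm_one_sub_kernelHat_le hs hO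
  set Γ := ∫ r in (0 : ℝ)..T, γ r with hΓdef
  have hπ := Real.two_pi_pos
  set B := (2 * Real.pi) ^ (2 * τ) * Γ with hB
  have hB0 : 0 < B := mul_pos (Real.rpow_pos_of_pos hπ _) hΓ
  set q := p / (2 * τ) with hq
  have hq0 : 0 < q := by positivity
  -- Chosen so that `ψ ≥ exp(-BκL) = β^{s/2}` for `|ξ| ≤ R`; then `β^{2s}/ψ²` still leaves a factor
  -- `β^s`.
  set κ := s / (2 * B) with hκ
  have hκ0 : 0 < κ := by positivity
  -- This leftover exponential beats every power of `L`, including the `L^q` needed to extract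
  -- `L^{-q}`.
  have hsmall : ∀ᶠ L in atTop, c ^ 2 * κ ^ (s / τ) * (L ^ (s / τ + q) * Real.exp (-s * L)) < 1 := by
    have h := (tendsto_rpow_mul_exp_neg_mul_atTop_nhds_zero (s / τ + q) s hs).const_mul
      (c ^ 2 * κ ^ (s / τ))
    rw [mul_zero] at h
    exact h.eventually (gt_mem_nhds one_pos)
  refine ⟨max 1 (κ ^ (-q)), lt_max_of_lt_left one_pos, ?_⟩
  filter_upwards [hsmall, eventually_gt_atTop 0] with L hL hL0 ξ
  set β := Real.exp (-L) with hβ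
  have hβ0 : 0 < β := Real.exp_pos _
  set R := (κ * L) ^ (1 / (2 * τ)) with hR
  have hR0 : 0 < R := by positivity
  have hRτ : R ^ (2 * τ) = κ * L := by
    rw [hR, ← Real.rpow_mul (by positivity), one_div_mul_cancel (by positivity), Real.rpow_one]
  have hN := normalSymbol_pos (τ := τ) (γ := γ) (T := T) (φ := φ) (β := β) ξ
  have hψ := psi_pos (τ := τ) (γ := γ) (T := T) ξ
  have hw1 : 1 ≤ (1 + ‖ξ‖ ^ 2) ^ (p / 2) :=
    Real.one_le_rpow (by nlinarith [norm_nonneg ξ]) (by positivity)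
  have hLq : 0 < L ^ (-q) := Real.rpow_pos_of_pos hL0 _
  rcases le_total ‖ξ‖ R with hξ | hξ
  · have h1 : Real.exp (-(s / 2 * L)) ≤ psi τ γ T ξ := by
      refine le_trans (le_of_eq ?_) (exp_neg_le_psi hτ hΓ hξ)
      congr 2
      rw [Real.mul_rpow hπ.le hR0.le, hRτ, mul_right_comm, ← hΓdef, ← hB, hκ]
      field_simp
    have h2 : ‖1 - kernelHat φ (β • ξ)‖ ≤ c * (β ^ s * R ^ s) := by
      refine (hle _).trans ?_
      rw [norm_smul, Real.norm_of_nonneg hβ0.le, Real.mul_rpow hβ0.le (norm_nonneg _)]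
      gcongr
    have hβs : β ^ s = Real.exp (-s * L) := by
      rw [hβ, ← Real.exp_mul]
      ring_nf
    have hRs : (R ^ s) ^ 2 = κ ^ (s / τ) * L ^ (s / τ) := by
      rw [hR, ← Real.rpow_mul (by positivity), ← Real.rpow_natCast, ← Real.rpow_mul (by positivity),
        ← Real.mul_rpow hκ0.le hL0.le]
      congr 1
      push_cast
      field_simp
    have hexp : Real.exp (-s * L) ^ 2 / Real.exp (-(s / 2 * L)) ^ 2 = Real.exp (-s * L) := by
      rw [← Real.exp_nat_mul, ← Real.exp_nat_mul, ← Real.exp_sub]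
      congr 1
      push_cast
      ring
    have hLL : L ^ (s / τ) = L ^ (s / τ + q) * L ^ (-q) := by
      rw [← Real.rpow_add hL0, add_neg_cancel_right]
    calc _ ≤ (c * (β ^ s * R ^ s)) ^ 2 / Real.exp (-(s / 2 * L)) ^ 2 := by
          gcongr
          rw [normalSymbol]
          calc _ ≤ psi τ γ T ξ ^ 2 := by gcongr
            _ ≤ _ := le_add_of_nonneg_right (sq_nonneg _)
      _ = c ^ 2 * (R ^ s) ^ 2 * (Real.exp (-s * L) ^ 2 / Real.exp (-(s / 2 * L)) ^ 2) := by
          rw [hβs]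
          ring
      _ = (c ^ 2 * κ ^ (s / τ) * (L ^ (s / τ + q) * Real.exp (-s * L))) * L ^ (-q) := by
          rw [hexp, hRs, hLL]
          ring
      _ ≤ 1 * L ^ (-q) := by gcongr
      _ ≤ max 1 (κ ^ (-q)) * L ^ (-q) := by gcongr; exact le_max_left _ _
      _ ≤ _ := le_mul_of_one_le_right (by positivity) hw1
  -- High frequencies: `(κL)^q = R^p`, which the Sobolev weight dominates.
  · have h1 : (κ * L) ^ q ≤ (1 + ‖ξ‖ ^ 2) ^ (p / 2) := by
      have h2 : (κ * L) ^ q = (R ^ 2) ^ (p / 2) := by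
        rw [← Real.rpow_natCast, ← Real.rpow_mul hR0.le, hR, ← Real.rpow_mul (by positivity), hq]
        congr 1
        push_cast
        field_simp
      rw [h2]
      refine Real.rpow_le_rpow (sq_nonneg _) ?_ (by positivity)
      nlinarith
    calc _ ≤ (1 : ℝ) := by
          rw [div_le_one hN, normalSymbol]
          exact le_add_of_nonneg_left (sq_nonneg _)
      _ = κ ^ (-q) * L ^ (-q) * (κ * L) ^ q := by
          rw [← Real.mul_rpow hκ0.le hL0.le, ← Real.rpow_add (by positivity), neg_add_cancel,
            Real.rpow_zero]
      _ ≤ _ := by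
          gcongr
          exact le_max_right _ _

end Bias

/-! ### Error decomposition -/

section Error

variable {τ T : ℝ} {γ : ℝ → ℝ} {φ : Rn n → ℝ}

/-- Bias and noise bounds on the Fourier side control the reconstruction error. -/
theorem norm_sub_le_of_symbol_le {p β M₁ M₂ E δ : ℝ} (hM₁ : 0 ≤ M₁) (hM₂ : 0 ≤ M₂)
    (hE : 0 ≤ E) (hδ : 0 ≤ δ)
    (h₁ : ∀ ξ : Rn n, ‖1 - kernelHat φ (β • ξ)‖ ^ 2 / normalSymbol τ γ T φ β ξ ≤
      M₁ * (1 + ‖ξ‖ ^ 2) ^ (p / 2))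
    (h₂ : ∀ ξ : Rn n, psi τ γ T ξ / normalSymbol τ γ T φ β ξ ≤ M₂)
    (hτ : 0 < τ) (hφ : Integrable φ volume) {f g gδ v : L2 n}
    (hg : (𝓕 g : L2 n) =ᵐ[volume] fun ξ => (psi τ γ T ξ : ℂ) * (𝓕 f : L2 n) ξ)
    (hv : (𝓕 v : L2 n) =ᵐ[volume]
      fun ξ => ((psi τ γ T ξ / normalSymbol τ γ T φ β ξ : ℝ) : ℂ) * (𝓕 gδ : L2 n) ξ)
    (hf : sobolevNorm p f ≤ ENNReal.ofReal E) (hgδ : ‖g - gδ‖ ≤ δ) :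
    ‖f - v‖ ≤ M₁ * E + M₂ * δ := by
  have hN0 : ∀ ξ : Rn n, 0 < normalSymbol τ γ T φ β ξ := normalSymbol_pos
  have hNc := continuous_normalSymbol (β := β) (γ := γ) (T := T) hτ hφ
  have hb : Continuous fun ξ : Rn n => ‖1 - kernelHat φ (β • ξ)‖ ^ 2 :=
    (continuous_const.sub ((continuous_kernelHat hφ).comp (continuous_const_smul β))).norm.pow 2
  set a : Rn n → ℝ := fun ξ => ‖1 - kernelHat φ (β • ξ)‖ ^ 2 / normalSymbol τ γ T φ β ξ with ha
  set b : Rn n → ℝ := fun ξ => psi τ γ T ξ / normalSymbol τ γ T φ β ξ with hbdef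
  have hac : Continuous a := hb.div hNc fun ξ => (hN0 ξ).ne'
  have hbc : Continuous b := (continuous_psi hτ).div hNc fun ξ => (hN0 ξ).ne'
  have hdecomp : (𝓕 (f - v) : L2 n) =ᵐ[volume]
      (fun ξ => (a ξ : ℂ) * (𝓕 f : L2 n) ξ) + fun ξ => (b ξ : ℂ) * (𝓕 (g - gδ) : L2 n) ξ := by
    filter_upwards [fourier_sub_ae f v, fourier_sub_ae g gδ, hg, hv] with ξ e1 e2 e3 e4
    -- Since `N = ψ² + |m|²`, the bias factor `|m|²/N` is `1 - (ψ/N)ψ`.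
    have hab : (a ξ : ℂ) = 1 - (b ξ : ℂ) * (psi τ γ T ξ : ℂ) := by
      have : a ξ = 1 - b ξ * psi τ γ T ξ := by
        have := (hN0 ξ).ne'
        simp only [ha, hbdef]
        field_simp
        rw [normalSymbol]
        ring
      rw [this]
      push_cast
      ring
    rw [Pi.add_apply, e1, e2, e3, e4, hab]
    ring
  rw [← ENNReal.ofReal_le_ofReal_iff (by positivity), ofReal_norm_eq_eLpNorm_fourier,
    eLpNorm_congr_ae hdecomp, ENNReal.ofReal_add (by positivity) (by positivity),
    ENNReal.ofReal_mul hM₁, ENNReal.ofReal_mul hM₂]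
  refine (eLpNorm_add_le
    ((Complex.continuous_ofReal.comp hac).aestronglyMeasurable.mul (Lp.memLp _).1)
    ((Complex.continuous_ofReal.comp hbc).aestronglyMeasurable.mul (Lp.memLp _).1)
    (by norm_num)).trans (add_le_add ?_ ?_)
  · refine le_trans ?_ (mul_le_mul_right hf _)
    refine eLpNorm_le_mul_eLpNorm_of_ae_le_mul (Eventually.of_forall fun ξ => ?_) 2
    have hw0 : 0 ≤ (1 + ‖ξ‖ ^ 2) ^ (p / 2) := by positivity
    have ha0 : 0 ≤ a ξ := div_nonneg (sq_nonneg _) (hN0 ξ).le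
    rw [Pi.mul_apply, Function.comp_apply, norm_mul, norm_mul, Complex.norm_real,
      Complex.norm_real, Real.norm_of_nonneg ha0,
      Real.norm_of_nonneg hw0, ← mul_assoc M₁]
    exact mul_le_mul_of_nonneg_right (h₁ ξ) (norm_nonneg ((𝓕 f : L2 n) ξ))
  · refine le_trans ?_ (mul_le_mul_right (ENNReal.ofReal_le_ofReal hgδ) _)
    rw [ofReal_norm_eq_eLpNorm_fourier]
    refine eLpNorm_le_mul_eLpNorm_of_ae_le_mul (Eventually.of_forall fun ξ => ?_) 2
    have hb0 : 0 ≤ b ξ := div_nonneg (psi_pos ξ).le (hN0 ξ).le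
    rw [Pi.mul_apply, Function.comp_apply, norm_mul, Complex.norm_real, Real.norm_of_nonneg hb0]
    exact mul_le_mul_of_nonneg_right (h₂ ξ) (norm_nonneg ((𝓕 (g - gδ) : L2 n) ξ))

end Error

/-! ### The index function `Θ_q` and its inverse -/

section Rate

theorem logRate_pos {q t : ℝ} (ht : t ∈ Ioo (0 : ℝ) 1) : 0 < logRate q t :=
  Real.rpow_pos_of_pos (neg_pos.2 (Real.log_neg ht.1 ht.2)) _

theorem thetaInv_mem {q y : ℝ} (hq : 0 < q) (hy : 0 < y) : thetaInv q y ∈ Ioo (0 : ℝ) 1 :=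
  Function.invFunOn_mem ((theta_bijOn hq).surjOn hy)

theorem Theta_thetaInv {q y : ℝ} (hq : 0 < q) (hy : 0 < y) : Theta q (thetaInv q y) = y :=
  Function.invFunOn_eq ((theta_bijOn hq).surjOn hy)

theorem Theta_monotoneOn {q : ℝ} (hq : 0 < q) : MonotoneOn (Theta q) (Ioo 0 1) := by
  intro a ha b hb hab
  have h : logRate q a ≤ logRate q b :=
    Real.rpow_le_rpow_of_nonpos (neg_pos.2 (Real.log_neg hb.1 hb.2))
      (neg_le_neg (Real.log_le_log ha.1 hab)) (by linarith)
  exact mul_le_mul (Real.sqrt_le_sqrt hab) h (logRate_pos ha).le (Real.sqrt_nonneg _)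

theorem tendsto_thetaInv {q : ℝ} (hq : 0 < q) : Tendsto (thetaInv q) (𝓝[>] 0) (𝓝[>] 0) := by
  refine tendsto_nhdsWithin_iff.2 ⟨?_, ?_⟩
  · refine (nhdsGT_basis (0 : ℝ)).tendsto_iff (Metric.nhds_basis_ball (x := (0 : ℝ))) |>.2
      fun ε hε => ?_
    set ε' := min ε (1 / 2) with hε'
    have hε'0 : 0 < ε' := by positivity
    have hmem : ε' ∈ Ioo (0 : ℝ) 1 := ⟨hε'0, (min_le_right _ _).trans_lt (by norm_num)⟩
    refine ⟨Theta q ε', (theta_bijOn hq).mapsTo hmem, fun y hy => ?_⟩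
    have hα := thetaInv_mem hq hy.1
    have hlt : thetaInv q y < ε' := by
      by_contra! h
      have := Theta_monotoneOn hq hmem hα h
      rw [Theta_thetaInv hq hy.1] at this
      exact absurd hy.2 (not_lt.2 this)
    rw [Metric.mem_ball, dist_zero_right, Real.norm_of_nonneg hα.1.le]
    exact hlt.trans_le (min_le_left _ _)
  · filter_upwards [self_mem_nhdsWithin] with y hy using (thetaInv_mem hq hy).1

/-- Up to a constant, `f_q(t)` is bounded by `f_q(Θ_q(t)²)`. -/
theorem logRate_le_logRate_Theta_sq {q t : ℝ} (hq : 0 < q) (ht : 0 < t) (hlog : 1 ≤ -Real.log t) :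
    logRate q t ≤ (1 + 2 * q) ^ q * logRate q (Theta q t ^ 2) := by
  set l := -Real.log t with hl
  have hl0 : 0 < l := zero_lt_one.trans_le hlog
  have hll : 0 ≤ Real.log l := Real.log_nonneg hlog
  -- `Θ_q(t)² = t l^{-2q}`, and `log l ≤ l` bounds the right side by `(1 + 2q) l`; this is the
  -- source of the constant.
  have h1 : -Real.log (Theta q t ^ 2) = l + 2 * q * Real.log l := by
    rw [Theta, logRate, ← hl, mul_pow, Real.sq_sqrt ht.le, Real.log_mul ht.ne' (by positivity),
      Real.log_pow, Real.log_rpow hl0, hl]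
    push_cast
    ring
  rw [logRate, logRate, h1, ← hl]
  calc l ^ (-q) = (1 + 2 * q) ^ q * ((1 + 2 * q) * l) ^ (-q) := by
        rw [Real.mul_rpow (by positivity) hl0.le, ← mul_assoc, ← Real.rpow_add (by positivity),
          add_neg_cancel, Real.rpow_zero, one_mul]
    _ ≤ _ := by
        refine mul_le_mul_of_nonneg_left ?_ (by positivity)
        refine Real.rpow_le_rpow_of_nonpos (by positivity) ?_ (by linarith)
        have := Real.log_le_self hl0.le
        nlinarith

end Rate

end BackwardHeat

/-! ### Assembly -/

theorem mainTheorem1 (n : ℕ) (τ T p s : ℝ) (γ : ℝ → ℝ) (φ : BackwardHeat.Rn n → ℝ)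
    (hτ : 0 < τ) (hτ1 : τ ≤ 1) (hT : 0 < T) (hp : 0 < p) (hs : 0 < s)
    (hγ_pos : ∀ t ∈ Ioo 0 T, 0 < γ t) (hγ_int : IntegrableOn γ (Ioo 0 T) volume)
    (hφ_int : Integrable φ volume) (hφ_one : ∫ x, φ x = 1)
    (hφ_lt : ∀ ξ : BackwardHeat.Rn n, ξ ≠ 0 → ‖BackwardHeat.kernelHat φ ξ‖ < 1)
    (hφ_order : (fun ξ : BackwardHeat.Rn n => ‖1 - BackwardHeat.kernelHat φ ξ‖)
      =Θ[𝓝 0] (fun ξ => ‖ξ‖ ^ s)) :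
    -- the regularized solution is well defined for every parameter and all data
    (∀ β : ℝ, 0 < β → ∀ h : BackwardHeat.L2 n,
      ∃! v, BackwardHeat.IsRegularizedSolution τ γ T φ β h v) ∧
    -- a constant `C(p)` of the logarithmic source condition exists
    (∃ C : ℝ, 0 < C ∧ ∀ E : ℝ, 0 < E → ∀ f : BackwardHeat.L2 n,
      BackwardHeat.sobolevNorm p f ≤ ENNReal.ofReal E →
        ∃ w : BackwardHeat.L2 n,
          f = BackwardHeat.logSourceOp τ γ T (p / (2 * τ)) w ∧ ‖w‖ ≤ C * E) ∧
    -- the convergence rate, with `ρ = C E`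
    (∀ C : ℝ, 0 < C → ∃ K : ℝ, 0 < K ∧ ∀ E : ℝ, 0 < E →
      ∃ η : ℝ → ℝ, Tendsto η (𝓝[>] 0) (𝓝 0) ∧
        ∀ᶠ δ in 𝓝[>] (0 : ℝ),
          ∀ (u : ℝ → BackwardHeat.L2 n) (g gδ v : BackwardHeat.L2 n),
            BackwardHeat.IsSolution τ γ T u → u T = g →
            BackwardHeat.sobolevNorm p (u 0) ≤ ENNReal.ofReal E →
            ‖g - gδ‖ ≤ δ →
            BackwardHeat.IsRegularizedSolution τ γ T φ
              (BackwardHeat.betaRule (p / (2 * τ)) s (C * E) δ) gδ v →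
            ‖u 0 - v‖ ≤ K * (C * E) *
              BackwardHeat.logRate (p / (2 * τ)) (δ ^ 2 / (C * E) ^ 2) * (1 + η δ)) := by
  have hΓ := BackwardHeat.integral_pos_of_pos_on_Ioo hT hγ_pos hγ_int
  have hγ : IntervalIntegrable γ volume 0 T :=
    (intervalIntegrable_iff_integrableOn_Ioo_of_le hT.le).2 hγ_int
  refine ⟨fun β hβ h => ?_, BackwardHeat.exists_logSourceOp_eq hτ hp hΓ, fun C hC => ?_⟩
  · obtain ⟨w, hw⟩ := BackwardHeat.exists_fourier_eq_psi_div_normalSymbol_mul hs hτ hΓ hφ_int hφ_lt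
      hφ_order.2 hβ h
    have hiff := BackwardHeat.isRegularizedSolution_iff hτ hΓ hφ_int hβ hw
    exact ⟨w, (hiff w).2 rfl, fun v hv => (hiff v).1 hv⟩
  obtain ⟨c₁, hc₁, hbias⟩ := BackwardHeat.exists_sq_div_normalSymbol_le hτ hp hs hΓ hφ_order.1
  obtain ⟨c₂, hc₂, hnoise⟩ := BackwardHeat.exists_psi_div_normalSymbol_le hs hτ hΓ hφ_int hφ_lt
    hφ_order.2
  set q := p / (2 * τ) with hq
  have hq0 : 0 < q := by positivity
  -- The summands come from bias and noise, with `1/C` converting `E` into `ρ`; the prefactor passes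
  -- from `f_q(α)` to `f_q(δ²/ρ²)`. The bound holds for small `δ` with `o(1) = 0`.
  refine ⟨(1 + 2 * q) ^ q * (c₁ * (2 * s) ^ q / C + c₂), by positivity, fun E hE =>
    ⟨fun _ => 0, tendsto_const_nhds, ?_⟩⟩
  have hρ : 0 < C * E := by positivity
  have hscale : Tendsto (fun δ : ℝ => δ / (C * E)) (𝓝[>] 0) (𝓝[>] 0) := by
    refine tendsto_nhdsWithin_iff.2 ⟨?_, ?_⟩
    · have := (tendsto_id (α := ℝ) (x := 𝓝 0)).div_const (C * E)
      rw [zero_div] at this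
      exact this.mono_left nhdsWithin_le_nhds
    · filter_upwards [self_mem_nhdsWithin] with δ hδ using div_pos hδ hρ
  have hlog : Tendsto (fun δ : ℝ => -Real.log (BackwardHeat.thetaInv q (δ / (C * E))))
      (𝓝[>] 0) atTop :=
    tendsto_neg_atBot_atTop.comp (Real.tendsto_log_nhdsGT_zero.comp
      ((BackwardHeat.tendsto_thetaInv hq0).comp hscale))
  have hL := hlog.atTop_div_const (show 0 < 2 * s by positivity)
  filter_upwards [self_mem_nhdsWithin, hlog.eventually_ge_atTop 1, hL.eventually hbias]
    with δ (hδ : 0 < δ) hlog1 hbiasδ u g gδ v hu huT hu0 hgδ hv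
  have hy : 0 < δ / (C * E) := div_pos hδ hρ
  have hα := BackwardHeat.thetaInv_mem hq0 hy
  have hΘ := BackwardHeat.Theta_thetaInv hq0 hy
  set α := BackwardHeat.thetaInv q (δ / (C * E)) with hαdef
  -- In the form `β = e^{-L}` of the bias bound, `L = -ln α / (2s)`.
  have hβ : BackwardHeat.betaRule q s (C * E) δ = Real.exp (-(-Real.log α / (2 * s))) := by
    rw [BackwardHeat.betaRule, ← hαdef, Real.rpow_def_of_pos hα.1]
    congr 1
    ring
  rw [hβ] at hv
  set β := Real.exp (-(-Real.log α / (2 * s))) with hβdef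
  have hβ0 : 0 < β := Real.exp_pos _
  have hβs : β ^ s = Real.sqrt α := by
    rw [← hβ, BackwardHeat.betaRule, ← hαdef, ← Real.rpow_mul hα.1.le, Real.sqrt_eq_rpow]
    congr 1
    field_simp
  have hsqrt : 0 < Real.sqrt α := Real.sqrt_pos.2 hα.1
  have hnoiseβ := hnoise β hβ0
  rw [hβs, min_eq_right (Real.sqrt_le_one.2 hα.2.le)] at hnoiseβ
  obtain ⟨w, hw⟩ := BackwardHeat.exists_fourier_eq_psi_div_normalSymbol_mul hs hτ hΓ hφ_int hφ_lt
    hφ_order.2 hβ0 gδ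
  obtain rfl := (BackwardHeat.isRegularizedSolution_iff hτ hΓ hφ_int hβ0 hw v).1 hv
  have hg := huT ▸ hu.fourier_ae_eq hT.le hγ
  have hl0 : 0 < -Real.log α := zero_lt_one.trans_le hlog1
  have hLq : (-Real.log α / (2 * s)) ^ (-q) = (2 * s) ^ q * BackwardHeat.logRate q α := by
    rw [BackwardHeat.logRate, Real.div_rpow hl0.le (by positivity),
      Real.rpow_neg (show 0 ≤ 2 * s by positivity), div_inv_eq_mul, mul_comm]
  have hf0 := BackwardHeat.logRate_pos (q := q) hα
  have hrate := BackwardHeat.logRate_le_logRate_Theta_sq hq0 hα.1 hlog1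
  rw [hΘ, div_pow] at hrate
  -- `Θ_q(α) = δ/ρ` says exactly that `δ/√α = ρ f_q(α)`, which balances noise against bias.
  have hδeq : δ = C * E * (Real.sqrt α * BackwardHeat.logRate q α) := by
    rw [← BackwardHeat.Theta, hΘ]
    field_simp
  have hnoiseδ : c₂ / Real.sqrt α * δ = c₂ * (C * E) * BackwardHeat.logRate q α := by
    refine (congrArg (c₂ / Real.sqrt α * ·) hδeq).trans ?_
    field_simp
  have herr := BackwardHeat.norm_sub_le_of_symbol_le (by positivity) (by positivity) hE.le hδ.le
    hbiasδ hnoiseβ hτ hφ_int hg hw hu0 hgδ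
  rw [add_zero, mul_one]
  calc _ ≤ _ := herr
    _ = C * E * (c₁ * (2 * s) ^ q / C + c₂) * BackwardHeat.logRate q α := by
        rw [hLq, hnoiseδ]
        field_simp
    _ ≤ C * E * (c₁ * (2 * s) ^ q / C + c₂) *
        ((1 + 2 * q) ^ q * BackwardHeat.logRate q (δ ^ 2 / (C * E) ^ 2)) := by gcongr
    _ = _ := by ring
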